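/- **Model.** Let $K\ge 2$, $1\le s\le d$, $\sigma>0$, $p(t)=1/(1+e^{-t})$. An instance $\mu$ consists of $\theta^*,\beta_1^*,\beta_2^*\in\mathbb R^d$ with $\beta^*_1\neq\beta^*_2$ and a joint law of features $(x_1,\dots,x_K,z)\in(\mathbb R^d)^K\times\mathbb R^d$. Customers $i=1,\dots,T$ are i.i.d.: the features $(x_{i,1},\dots,x_{i,K},z_i)$ follow this law; given the features, the latent group is $g_i=1$ with probability $p(z_i^\top\theta^*)$ and $g_i=2$ otherwise; and $\epsilon_i\sim N(0,\sigma^2)$ is independent noise. A policy $\hat\pi$ chooses (possibly at random) an arm $\hat a_i\in[K]$ from the features of customer $i$ and the past features, arms and rewards; the reward is $\langle x_{i,\hat a_i},\beta^*_{g_i}\rangle+\epsilon_i$, and $g_i$ is never observed. Put $G(z)=1$ if $p(z^\top\theta^*)\ge 1/2$, $G(z)=2$ otherwise, $R(\theta^*)=\mathbb P(G(z)\ne g)$, and $\tilde a_i=\arg\max_k\langle x_{i,k},\beta^*_{G(z_i)}\rangle$. The cumulative strong and regular regrets are $$\mathrm{Reg}^*(T)=\sum_{i=1}^T\mathbb E\Big[\max_k\langle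 x_{i,k},\beta^*_{g_i}\rangle-\langle x_{i,\hat a_i},\beta^*_{g_i}\rangle\Big],\qquad \widetilde{\mathrm{Reg}}(T)=\sum_{i=1}^T\mathbb E\Big[\langle x_{i,\tilde a_i},\beta^*_{g_i}\rangle-\langle x_{i,\hat a_i},\beta^*_{g_i}\rangle\Big].$$ **Class.** For $\bar x,\bar L>0$ and constants $\xi\in(0,1/2)$, $M>1$, $\kappa,C,\bar h>0$, let $\mathcal P=\mathcal P_{d,s,\bar x,\bar L}$ be the set of instances such that $\theta^*,\beta_1^*,\beta_2^*$ have at most $s$ non-zero entries and * (A1) $\xi<p(z^\top\theta^*)<1-\xi$ almost surely; * (A4) for each $k$ the vector $(x_k,z)$ is sub-Gaussian with constant $\kappa$ (that is, $\mathbb E\exp(\langle u,(x_k,z)\rangle^2/\kappa^2)\le 2$ for all unit vectors $u$), and all eigenvalues of $\mathbb E[x_kx_k^\top]$ and of $\mathbb E[zz^\top]$ lie in $(1/M,M)$; * (B1) $\|x_k\|_\infty\le\bar x$ almost surely for all $k$, and $\|\beta_g^*\|_1\le\bar L$ for $g=1,2$; * (B2) for $g=1,2$ and $h\in[0,\bar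 h]$, with $a_g=\arg\max_k\langle x_k,\beta^*_g\rangle$: $\mathbb P\big(\langle x_{a_g},\beta_g^*\rangle\le\max_{k\ne a_g}\langle x_k,\beta^*_g\rangle+h\big)\le Ch$. **Theorem.** 1. There is a universal constant $c>0$ with the following property. For all $\bar x,\bar L>0$ there are $M_0,\kappa_0,h_0>0$ such that, for all $\xi\in(0,1/2)$, $M>1$ with $M\ge M_0$, $C>0$, $0<\bar h\le h_0$, $\kappa_z>0$, $\kappa\ge\kappa_0+\kappa_z$, $\sigma>0$, $K\ge2$, $1\le s\le d$, $T\ge 0$, for every $s$-sparse $\theta^*$ and every law of $z$ that satisfy (A1), are sub-Gaussian with constant $\kappa_z$ and have all eigenvalues of $\mathbb E[zz^\top]$ in $(1/M,M)$, and for every policy, some $\mu\in\mathcal P$ with this $\theta^*$ and this law of $z$ has $$\mathrm{Reg}^*(T)\ \ge\ c\,\bar x\,\bar L\,R(\theta^*)\,T .$$ 2. For all $A>0$ and $\xi\in(0,1/2)$ there is $c>0$ with the following property. For all $\bar x,\bar L>0$ there are $M_0,\kappa_0,h_0>0$ such that, for all $M>1$ with $M\ge M_0$, $\kappa\ge\kappa_0$,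 $C>0$, $0<\bar h\le h_0$, $\sigma>0$, $K\ge2$, all $1\le s\le d$ and $T\ge 0$ with $\log d\le A\log(d/s)$ and $s\log d\le A\,T$, and for every policy, some $\mu\in\mathcal P$ has $$\widetilde{\mathrm{Reg}}(T)\ \ge\ c\,\bar x\,\bar L\,\sqrt{s\log d}\,\sqrt T .$$ -/

import Mathlib

open MeasureTheory ProbabilityTheory
open scoped NNReal

noncomputable section

namespace LatentBandit

/-! ### The latent heterogeneous linear bandit model

Groups are labelled by `Fin 2`: label `0` is the first subgroup, label `1` is the second. -/

/-- The observable features of one customer: the vectors `x k` of the `K` arms and the customer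
feature `z`. -/
abbrev Ctx (K d : ℕ) : Type := (Fin K → Fin d → ℝ) × (Fin d → ℝ)

/-- Subgroup model: given `z`, the group is the first one with probability `p(zᵀθ)` and the second
one with probability `1 - p(zᵀθ)`, where `p` is the logistic function. -/
def groupKernel {d : ℕ} (θ : Fin d → ℝ) : Kernel (Fin d → ℝ) (Fin 2) where
  toFun z :=
    ENNReal.ofReal (Real.sigmoid (z ⬝ᵥ θ)) • Measure.dirac 0 +
      ENNReal.ofReal (1 - Real.sigmoid (z ⬝ᵥ θ)) • Measure.dirac 1
  measurable' := by
    have hm : Measurable fun z : Fin d → ℝ => Real.sigmoid (z ⬝ᵥ θ) :=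
      continuous_sigmoid.measurable.comp
        (Continuous.dotProduct continuous_id continuous_const).measurable
    refine Measure.measurable_of_measurable_coe _ fun s _ => ?_
    simp only [Measure.coe_add, Measure.coe_smul, Pi.add_apply, Pi.smul_apply, smul_eq_mul]
    exact (hm.ennreal_ofReal.mul_const _).add
      ((measurable_const.sub hm).ennreal_ofReal.mul_const _)

instance {d : ℕ} (θ : Fin d → ℝ) : IsMarkovKernel (groupKernel θ) where
  isProbabilityMeasure z := ⟨by
    change (ENNReal.ofReal (Real.sigmoid (z ⬝ᵥ θ)) • Measure.dirac (0 : Fin 2) +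
      ENNReal.ofReal (1 - Real.sigmoid (z ⬝ᵥ θ)) • Measure.dirac (1 : Fin 2)) Set.univ = 1
    simp only [Measure.coe_add, Measure.coe_smul, Pi.add_apply, Pi.smul_apply, smul_eq_mul,
      measure_univ, mul_one]
    rw [← ENNReal.ofReal_add (Real.sigmoid_nonneg _)
      (sub_nonneg.2 (Real.sigmoid_le_one _))]
    simp⟩

/-- A bandit instance with `K` arms in dimension `d`: the parameters `(θ, β₁, β₂)` and the joint
law of the features `(x, z)` of a customer. -/
structure Instance (K d : ℕ) where
  /-- parameter of the subgroup model -/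
  θ : Fin d → ℝ
  /-- parameters of the reward model, one for each group -/
  β : Fin 2 → Fin d → ℝ
  /-- law of the features of one customer -/
  ctxLaw : Measure (Ctx K d)
  /-- it is a probability measure -/
  isProb : IsProbabilityMeasure ctxLaw

attribute [instance] Instance.isProb

namespace Instance

variable {K d : ℕ}

/-- The law of the customer feature `z`. -/
def zLaw (μ : Instance K d) : Measure (Fin d → ℝ) := μ.ctxLaw.map Prod.snd

/-- The law of `((x, z), g, ε)` for one customer: features, latent group and reward noise.
The group depends on the features through `z` only, and the noise is `N(0, σ²)` and independent
of everything else. -/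
def latentLaw (μ : Instance K d) (σ : ℝ≥0) : Measure (Ctx K d × Fin 2 × ℝ) :=
  μ.ctxLaw ⊗ₘ (((groupKernel μ.θ).comap Prod.snd measurable_snd) ×ₖ
    Kernel.const (Ctx K d) (gaussianReal 0 (σ ^ 2)))

/-- The expected reward `⟨x k, β g⟩` of arm `k` in group `g`. -/
def meanReward (μ : Instance K d) (x : Fin K → Fin d → ℝ) (g : Fin 2) (k : Fin K) : ℝ :=
  x k ⬝ᵥ μ.β g

end Instance

/-! ### Policies and the law of the interaction -/

/-- What is observed about one customer: features, chosen arm, received reward. -/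
abbrev Obs (K d : ℕ) : Type := Ctx K d × Fin K × ℝ

/-- The history of the first `n` customers. -/
abbrev Hist (K d n : ℕ) : Type := Fin n → Obs K d

/-- A (possibly randomized) policy: for each `n`, the conditional law of the arm offered to
customer `n` (counted from `0`), given the history of the previous `n` customers and the
features of the present one. -/
structure Policy (K d : ℕ) where
  /-- conditional law of the next arm -/
  act : ∀ n : ℕ, Kernel (Hist K d n × Ctx K d) (Fin K)
  /-- it is a probability measure -/
  isMarkov : ∀ n, IsMarkovKernel (act n)

attribute [instance] Policy.isMarkov

section Interaction

variable {K d : ℕ} (μ : Instance K d) (σ : ℝ≥0) (π : Policy K d)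

/-- Given the history of the first `n` customers: the conditional law of
`(((x, z), g, ε), a)` for the next customer. -/
def roundKernel (n : ℕ) : Kernel (Hist K d n) ((Ctx K d × Fin 2 × ℝ) × Fin K) :=
  Kernel.const (Hist K d n) (μ.latentLaw σ) ⊗ₖ
    (π.act n).comap (fun q : Hist K d n × (Ctx K d × Fin 2 × ℝ) => (q.1, q.2.1))
      (by fun_prop)

/-- The observation produced in one round: the reward is `⟨x a, β g⟩ + ε`. -/
def observe (w : (Ctx K d × Fin 2 × ℝ) × Fin K) : Obs K d :=
  (w.1.1, w.2, μ.meanReward w.1.1.1 w.1.2.1 w.2 + w.1.2.2)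

/-- The law of the history of the first `n` customers. -/
def histLaw : ∀ n : ℕ, Measure (Hist K d n)
  | 0 => Measure.dirac Fin.elim0
  | n + 1 => ((histLaw n) ⊗ₘ (roundKernel μ σ π n)).map
      fun q => Fin.snoc (α := fun _ => Obs K d) q.1 (observe μ q.2)

instance (μ : Instance K d) (σ : ℝ≥0) : IsProbabilityMeasure (μ.latentLaw σ) := by
  unfold Instance.latentLaw; infer_instance

instance (n : ℕ) : IsMarkovKernel (roundKernel μ σ π n) := by
  unfold roundKernel; infer_instance

theorem measurable_observe : Measurable (observe μ) := by
  have h : Measurable fun w : (Ctx K d × Fin 2 × ℝ) × Fin K =>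
      μ.meanReward w.1.1.1 w.1.2.1 w.2 := by
    have h2 : Measurable fun q : ((Fin K → Fin d → ℝ) × Fin 2) × Fin K =>
        μ.meanReward q.1.1 q.1.2 q.2 := by
      refine measurable_from_prod_countable_left fun k => ?_
      refine measurable_from_prod_countable_left fun g => ?_
      have hc : Continuous fun x : Fin K → Fin d → ℝ => x k ⬝ᵥ μ.β g :=
        Continuous.dotProduct (continuous_apply k) continuous_const
      exact hc.measurable
    exact h2.comp (by fun_prop :
      Measurable fun w : (Ctx K d × Fin 2 × ℝ) × Fin K => ((w.1.1.1, w.1.2.1), w.2))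
  exact (measurable_fst.comp measurable_fst).prodMk
    (measurable_snd.prodMk (h.add (by fun_prop)))

theorem measurable_snoc_observe (n : ℕ) :
    Measurable fun q : Hist K d n × ((Ctx K d × Fin 2 × ℝ) × Fin K) =>
      (Fin.snoc (α := fun _ => Obs K d) q.1 (observe μ q.2) : Hist K d (n + 1)) := by
  refine measurable_pi_lambda _ fun i => ?_
  refine Fin.lastCases ?_ (fun j => ?_) i
  · simp only [Fin.snoc_last]
    exact (measurable_observe μ).comp measurable_snd
  · simp only [Fin.snoc_castSucc]
    exact (measurable_pi_apply j).comp measurable_fst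

instance (n : ℕ) : IsProbabilityMeasure (histLaw μ σ π n) := by
  induction n with
  | zero => unfold histLaw; infer_instance
  | succ n ih =>
    unfold histLaw
    exact Measure.isProbabilityMeasure_map (measurable_snoc_observe μ n).aemeasurable

/-- The law of `(((x, z), g, ε), a)` for customer `n`. -/
def roundLaw (n : ℕ) : Measure ((Ctx K d × Fin 2 × ℝ) × Fin K) :=
  ((histLaw μ σ π n) ⊗ₘ (roundKernel μ σ π n)).map Prod.snd

end Interaction

/-! ### Oracles, regrets and misclassification error -/

/-- The maximizer of `v` (the least one, if there are several). -/
def argmax {K : ℕ} [NeZero K] (v : Fin K → ℝ) : Fin K :=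
  (Finset.univ.filter fun k => ∀ j, v j ≤ v k).min' (by
    obtain ⟨k, hk⟩ := Finite.exists_max v
    exact ⟨k, by simpa using hk⟩)

/-- The Bayes classifier: first group iff `p(zᵀθ) ≥ 1/2`. -/
def classify {d : ℕ} (θ z : Fin d → ℝ) : Fin 2 :=
  if 1 / 2 ≤ Real.sigmoid (z ⬝ᵥ θ) then 0 else 1

/-- The misclassification error `R(θ) = P(G(z; θ) ≠ g)` of the Bayes classifier, when `z` has law
`ν` and `g` follows the subgroup model with parameter `θ`. -/
def misclassError {d : ℕ} (θ : Fin d → ℝ) (ν : Measure (Fin d → ℝ)) : ℝ :=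
  (ν ⊗ₘ groupKernel θ).real {q | classify θ q.1 ≠ q.2}

section Regret

variable {K d : ℕ} [NeZero K] (μ : Instance K d) (σ : ℝ≥0) (π : Policy K d)

/-- Instant strong regret: comparison with the oracle that knows the realized group. -/
def instantStrong (w : (Ctx K d × Fin 2 × ℝ) × Fin K) : ℝ :=
  (⨆ k, μ.meanReward w.1.1.1 w.1.2.1 k) - μ.meanReward w.1.1.1 w.1.2.1 w.2

/-- The arm of the regular oracle, who knows the parameters but not the realized group. -/
def regularArm (c : Ctx K d) : Fin K :=
  argmax fun k => μ.meanReward c.1 (classify μ.θ c.2) k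

/-- Instant regular regret: comparison with the regular oracle. -/
def instantRegular (w : (Ctx K d × Fin 2 × ℝ) × Fin K) : ℝ :=
  μ.meanReward w.1.1.1 w.1.2.1 (regularArm μ w.1.1) - μ.meanReward w.1.1.1 w.1.2.1 w.2

/-- Expected cumulative strong regret over the first `T` customers. -/
def strongRegret (T : ℕ) : ℝ :=
  ∑ n ∈ Finset.range T, ∫ w, instantStrong μ w ∂(roundLaw μ σ π n)

/-- Expected cumulative regular regret over the first `T` customers. -/
def regularRegret (T : ℕ) : ℝ :=
  ∑ n ∈ Finset.range T, ∫ w, instantRegular μ w ∂(roundLaw μ σ π n)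

end Regret

/-! ### Assumptions and the class of instances -/

/-- `v` has at most `s` non-zero entries. -/
def IsSparse {d : ℕ} (s : ℕ) (v : Fin d → ℝ) : Prop :=
  (Finset.univ.filter fun j => v j ≠ 0).card ≤ s

/-- The random vector `X` is sub-Gaussian with constant `κ`: each one-dimensional marginal in a
direction of Euclidean length one has `ψ₂`-norm at most `κ`. The vector need not be centred. -/
def IsSubGaussian {Ω ι : Type*} [MeasurableSpace Ω] [Fintype ι] (P : Measure Ω)
    (X : Ω → ι → ℝ) (κ : ℝ) : Prop :=
  ∀ u : ι → ℝ, ∑ i, u i ^ 2 = 1 →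
    ∫⁻ ω, ENNReal.ofReal (Real.exp ((X ω ⬝ᵥ u) ^ 2 / κ ^ 2)) ∂P ≤ 2

/-- The second-moment matrix `E[X Xᵀ]`. -/
def secondMoment {Ω : Type*} [MeasurableSpace Ω] {d : ℕ} (P : Measure Ω)
    (X : Ω → Fin d → ℝ) : Matrix (Fin d) (Fin d) ℝ :=
  Matrix.of fun i j => ∫ ω, X ω i * X ω j ∂P

/-- `1/M < λ_min(S) ≤ λ_max(S) < M`: each eigenvalue of `S` lies strictly between `1/M` and
`M`. -/
def EigenvaluesWithin {d : ℕ} (M : ℝ) (S : Matrix (Fin d) (Fin d) ℝ) : Prop :=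
  ∀ l : ℝ, Module.End.HasEigenvalue (Matrix.toLin' S) l → 1 / M < l ∧ l < M

/-- The group probabilities are bounded away from `0` and `1`. -/
def NondegenerateGroups {d : ℕ} (ξ : ℝ) (θ : Fin d → ℝ) (ν : Measure (Fin d → ℝ)) : Prop :=
  ∀ᵐ z ∂ν, ξ < Real.sigmoid (z ⬝ᵥ θ) ∧ Real.sigmoid (z ⬝ᵥ θ) < 1 - ξ

/-- The class of instances with sparsity `s`, feature bound `xbar`, parameter bound `Lbar` and
constants `ξ`, `M`, `κ`, `C`, `hbar` of the remaining assumptions. -/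
structure InClass {K d : ℕ} [NeZero K] (s : ℕ) (xbar Lbar ξ M κ C hbar : ℝ)
    (μ : Instance K d) : Prop where
  sparse_theta : IsSparse s μ.θ
  sparse_beta : ∀ g, IsSparse s (μ.β g)
  beta_ne : μ.β 0 ≠ μ.β 1
  nondegenerate : NondegenerateGroups ξ μ.θ μ.zLaw
  /-- for each arm, the joint vector `(x k, z)` is sub-Gaussian -/
  subGaussian : ∀ k, IsSubGaussian μ.ctxLaw (fun c => Sum.elim (c.1 k) c.2) κ
  eigenvalues_x : ∀ k, EigenvaluesWithin M (secondMoment μ.ctxLaw fun c => c.1 k)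
  eigenvalues_z : EigenvaluesWithin M (secondMoment μ.zLaw id)
  bounded_x : ∀ᵐ c ∂μ.ctxLaw, ∀ k j, |c.1 k j| ≤ xbar
  bounded_beta : ∀ g, ∑ j, |μ.β g j| ≤ Lbar
  /-- margin condition: a runner-up of the best arm for group `g` comes within `h` of it with
  probability at most `C h` -/
  margin : ∀ g, ∀ h ∈ Set.Icc 0 hbar,
    μ.ctxLaw.real {c | ∃ k, k ≠ argmax (μ.meanReward c.1 g) ∧
      μ.meanReward c.1 g (argmax (μ.meanReward c.1 g)) ≤ μ.meanReward c.1 g k + h} ≤ C * h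

end LatentBandit

end

/-!
All instances share one design. The groups have opposite coefficients, concentrated on the first
coordinate, and one random sign orients all arms, so that choosing an arm means guessing the group,
and a wrong guess costs `2 * xbar * Lbar`.

For the strong regret, no policy errs less often than the classifier that knows `θ`, because the
arms carry no information on the group beyond the feature `z`.

For the regular regret, `z` is a vector of random signs `r` conditioned on `|⟨r, θ⟩| ≤ b`. A policy
regrets, up to constants, `‖θ‖ / 3 - ⟨w, θ⟩`, where `w` is the vector of correlations of its
response with the signs; by Bessel's inequality `‖w‖ ≤ 1`. The prior puts one spike of random sign
and position in each of `s` blocks of `d / s` coordinates. Relative to the null model `θ = 0`, in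
which `w` is independent of the spikes, `T` rounds provide an entropy of order `T * ‖θ‖ ^ 2`. By the
Donsker–Varadhan inequality this keeps the prior average of `⟨w, θ⟩` below a fraction of `‖θ‖`, as
long as `‖θ‖ ^ 2` is of order at most `s * log d / T`.
-/

noncomputable section

namespace LatentBandit

open InformationTheory
open scoped ENNReal

/-! ### Relative entropy -/

section Entropy

variable {Ω Ω' : Type*} [MeasurableSpace Ω] [MeasurableSpace Ω']

/- Donsker–Varadhan: the relative entropy of `P` with respect to `Q` tilted by `F` is
nonnegative. -/
theorem integral_le_toReal_klDiv_add_log {P Q : Measure Ω} [IsProbabilityMeasure P]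
    [IsProbabilityMeasure Q] {F : Ω → ℝ} (hPQ : klDiv P Q ≠ ∞) (hF : Integrable F P)
    (hexp : Integrable (fun ω => Real.exp (F ω)) Q) :
    ∫ ω, F ω ∂P ≤ (klDiv P Q).toReal + Real.log (∫ ω, Real.exp (F ω) ∂Q) := by
  obtain ⟨hac, hllr⟩ := klDiv_ne_top_iff.1 hPQ
  have : IsProbabilityMeasure (Q.tilted F) := isProbabilityMeasure_tilted hexp
  have hac' : P ≪ Q.tilted F := hac.trans (absolutelyContinuous_tilted hexp)
  have hnonneg : 0 ≤ ∫ ω, llr P (Q.tilted F) ω ∂P := by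
    rw [← toReal_klDiv_of_measure_eq hac' (by simp)]
    exact ENNReal.toReal_nonneg
  rw [integral_llr_tilted_right hac hF hexp hllr,
    ← toReal_klDiv_of_measure_eq hac (by simp)] at hnonneg
  linarith

theorem klFun_le_sub_one_sq {x : ℝ} (hx : 0 ≤ x) : klFun x ≤ (x - 1) ^ 2 := by
  rcases hx.eq_or_lt with rfl | hpos
  · simp [klFun_apply]
  · rw [klFun_apply]
    nlinarith [mul_le_mul_of_nonneg_left (Real.log_le_sub_one_of_pos hpos) hx]

/- The right-hand side is the `χ²`-divergence. -/
theorem klDiv_withDensity_le {P Q : Measure Ω} [IsFiniteMeasure P] [IsFiniteMeasure Q]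
    {f : Ω → ℝ} (hf : Measurable f) (hf0 : 0 ≤ f)
    (hP : P = Q.withDensity fun ω => ENNReal.ofReal (f ω)) :
    klDiv P Q ≤ ∫⁻ ω, ENNReal.ofReal ((f ω - 1) ^ 2) ∂Q := by
  have hac : P ≪ Q := hP ▸ withDensity_absolutelyContinuous Q _
  rw [klDiv_eq_lintegral_klFun_of_ac hac]
  refine lintegral_mono_ae ?_
  have hrn : P.rnDeriv Q =ᵐ[Q] fun ω => ENNReal.ofReal (f ω) :=
    hP ▸ Q.rnDeriv_withDensity hf.ennreal_ofReal
  filter_upwards [hrn] with ω hω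
  rw [hω, ENNReal.toReal_ofReal (hf0 ω)]
  exact ENNReal.ofReal_le_ofReal (klFun_le_sub_one_sq (hf0 ω))

theorem klDiv_cond_le {P : Measure Ω} [IsProbabilityMeasure P] {S : Set Ω}
    (hS : MeasurableSet S) (hS0 : P S ≠ 0) :
    klDiv P[|S] P ≤ ENNReal.ofReal (P.real Sᶜ / P.real S) := by
  have hp : 0 < P.real S := ENNReal.toReal_pos hS0 (measure_ne_top _ _)
  have := cond_isProbabilityMeasure hS0
  set f : Ω → ℝ := S.indicator fun _ => (P.real S)⁻¹ with hf
  have hf0 : 0 ≤ f := fun ω => Set.indicator_nonneg (fun _ _ => by positivity) ω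
  have hdensity : P[|S] = P.withDensity fun ω => ENNReal.ofReal (f ω) := by
    have : (fun ω => ENNReal.ofReal (f ω)) = S.indicator fun _ => (P S)⁻¹ := by
      ext ω
      by_cases hω : ω ∈ S <;>
        simp [hf, hω, ENNReal.ofReal_inv_of_pos hp, ofReal_measureReal]
    rw [this, withDensity_indicator hS, withDensity_const, ProbabilityTheory.cond]
  have hsq : (fun ω => (f ω - 1) ^ 2) =
      fun ω => S.indicator (fun _ => ((P.real S)⁻¹ - 1) ^ 2) ω + Sᶜ.indicator 1 ω := by
    ext ω
    by_cases hω : ω ∈ S <;> simp [hf, hω]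
  have hint : ∫ ω, (f ω - 1) ^ 2 ∂P = P.real Sᶜ / P.real S := by
    rw [hsq, integral_add ((integrable_const _).indicator hS)
      ((integrable_const _).indicator hS.compl), integral_indicator_const _ hS,
      integral_indicator_one hS.compl, probReal_compl_eq_one_sub hS]
    simp only [smul_eq_mul]
    field_simp
    ring
  refine (klDiv_withDensity_le (by fun_prop (disch := exact hS)) hf0 hdensity).trans_eq ?_
  rw [← ofReal_integral_eq_lintegral_ofReal ?_ (.of_forall fun _ => sq_nonneg _), hint]
  rw [hsq]
  exact ((integrable_const _).indicator hS).add ((integrable_const _).indicator hS.compl)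

theorem klDiv_prod {P₁ P₂ : Measure Ω} {Q₁ Q₂ : Measure Ω'} [IsProbabilityMeasure P₁]
    [IsProbabilityMeasure P₂] [IsProbabilityMeasure Q₁] [IsProbabilityMeasure Q₂] :
    klDiv (P₁.prod Q₁) (P₂.prod Q₂) = klDiv P₁ P₂ + klDiv Q₁ Q₂ := by
  have hswap : klDiv (P₁.prod Q₁) (P₁.prod Q₂) ≤ klDiv Q₁ Q₂ := by
    rw [← Measure.prod_swap (μ := Q₁), ← Measure.prod_swap (μ := Q₂)]
    refine (klDiv_map_le _ _ measurable_swap).trans_eq ?_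
    rw [← Measure.compProd_const, ← Measure.compProd_const, klDiv_compProd_left]
  have hsnd : klDiv Q₁ Q₂ ≤ klDiv (P₁.prod Q₁) (P₁.prod Q₂) := by
    simpa using klDiv_map_le (P₁.prod Q₁) (P₁.prod Q₂) measurable_snd
  rw [← le_antisymm hswap hsnd]
  simp only [← Measure.compProd_const]
  exact klDiv_compProd_eq_add _ _ _ _

end Entropy

/-! ### The group label -/

/-- The sign that encodes a binary label: `1` for the first group, `-1` for the second. -/
def groupSign : Fin 2 → ℝ := ![1, -1]

@[simp]
theorem abs_groupSign (g : Fin 2) : |groupSign g| = 1 := by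
  fin_cases g <;> simp [groupSign]

theorem groupSign_mul_self (g : Fin 2) : groupSign g * groupSign g = 1 := by
  fin_cases g <;> simp [groupSign]

/-- The conditional mean of the group sign when the first group has log-odds `u`. -/
def groupBias (u : ℝ) : ℝ := 2 * Real.sigmoid u - 1

@[fun_prop]
theorem continuous_groupBias : Continuous groupBias :=
  (continuous_const.mul continuous_sigmoid).sub continuous_const

theorem abs_groupBias_le_one (u : ℝ) : |groupBias u| ≤ 1 := by
  rw [groupBias, abs_le]
  constructor <;> linarith [Real.sigmoid_nonneg u, Real.sigmoid_le_one u]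

theorem groupBias_neg (u : ℝ) : groupBias (-u) = -groupBias u := by
  rw [groupBias, groupBias, Real.sigmoid_neg]
  ring

theorem groupBias_eq_div (u : ℝ) :
    groupBias u = (1 - Real.exp (-u)) / (1 + Real.exp (-u)) := by
  have := Real.exp_pos (-u)
  rw [groupBias, Real.sigmoid_def]
  field_simp
  ring

theorem groupBias_nonneg {u : ℝ} (hu : 0 ≤ u) : 0 ≤ groupBias u := by
  have : Real.exp (-u) ≤ 1 := Real.exp_le_one_iff.2 (by linarith)
  rw [groupBias_eq_div]
  exact div_nonneg (by linarith) (by positivity)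

theorem abs_groupBias_le (u : ℝ) : |groupBias u| ≤ |u| := by
  wlog hu : 0 ≤ u generalizing u
  · simpa [groupBias_neg] using this (-u) (by linarith)
  rw [abs_of_nonneg (groupBias_nonneg hu), abs_of_nonneg hu, groupBias_eq_div,
    div_le_iff₀ (by positivity)]
  nlinarith [Real.add_one_le_exp (-u), Real.exp_pos (-u)]

theorem abs_abs_groupBias_sub_mul_le (u : ℝ) {y : ℝ} (hy : |y| ≤ 1) :
    |(|groupBias u| - groupBias u * y)| ≤ 2 := by
  have hmul : |groupBias u * y| ≤ 1 := by
    rw [abs_mul]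
    exact mul_le_one₀ (abs_groupBias_le_one u) (abs_nonneg y) hy
  linarith [abs_sub |groupBias u| (groupBias u * y), abs_abs (groupBias u), abs_groupBias_le_one u]

theorem div_four_le_groupBias {u : ℝ} (hu0 : 0 ≤ u) (hu1 : u ≤ 1) : u / 4 ≤ groupBias u := by
  have hexp : Real.exp (-u) ≤ 1 - u / 2 := by
    have h := Real.add_one_le_exp u
    rw [Real.exp_neg, inv_le_iff_one_le_mul₀ (Real.exp_pos u)]
    nlinarith
  rw [groupBias_eq_div, le_div_iff₀ (by positivity)]
  nlinarith

theorem abs_sub_mul_div_four_le_groupBias {u y : ℝ} (hu : |u| ≤ 1) (hy : |y| ≤ 1) :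
    (|u| - u * y) / 4 ≤ |groupBias u| - groupBias u * y := by
  wlog h0 : 0 ≤ u generalizing u y
  · simpa [groupBias_neg] using
      @this (-u) (-y) (by simpa using hu) (by simpa using hy) (by linarith)
  rw [abs_of_nonneg h0] at hu ⊢
  rw [abs_of_nonneg (groupBias_nonneg h0)]
  nlinarith [div_four_le_groupBias h0 hu, (abs_le.1 hy).2]

section GroupKernel

variable {d : ℕ} (θ z : Fin d → ℝ)

@[fun_prop]
theorem continuous_dotProduct_left (u : Fin d → ℝ) : Continuous fun r : Fin d → ℝ => r ⬝ᵥ u :=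
  Continuous.dotProduct continuous_id continuous_const

@[fun_prop]
theorem measurable_dotProduct_left (u : Fin d → ℝ) : Measurable fun r : Fin d → ℝ => r ⬝ᵥ u :=
  (continuous_dotProduct_left u).measurable

theorem lintegral_groupKernel (f : Fin 2 → ℝ≥0∞) :
    ∫⁻ g, f g ∂groupKernel θ z = ENNReal.ofReal (Real.sigmoid (z ⬝ᵥ θ)) * f 0 +
      ENNReal.ofReal (1 - Real.sigmoid (z ⬝ᵥ θ)) * f 1 := by
  change ∫⁻ g, f g ∂(ENNReal.ofReal (Real.sigmoid (z ⬝ᵥ θ)) • Measure.dirac 0 +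
      ENNReal.ofReal (1 - Real.sigmoid (z ⬝ᵥ θ)) • Measure.dirac 1) = _
  rw [lintegral_add_measure, lintegral_smul_measure, lintegral_smul_measure, lintegral_dirac,
    lintegral_dirac, smul_eq_mul, smul_eq_mul]

theorem integral_groupKernel (f : Fin 2 → ℝ) :
    ∫ g, f g ∂groupKernel θ z =
      Real.sigmoid (z ⬝ᵥ θ) * f 0 + (1 - Real.sigmoid (z ⬝ᵥ θ)) * f 1 := by
  change ∫ g, f g ∂(ENNReal.ofReal (Real.sigmoid (z ⬝ᵥ θ)) • Measure.dirac 0 +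
      ENNReal.ofReal (1 - Real.sigmoid (z ⬝ᵥ θ)) • Measure.dirac 1) = _
  rw [integral_add_measure (Integrable.of_finite.smul_measure (by simp))
      (Integrable.of_finite.smul_measure (by simp)),
    integral_smul_measure, integral_smul_measure, integral_dirac, integral_dirac,
    ENNReal.toReal_ofReal (Real.sigmoid_nonneg _),
    ENNReal.toReal_ofReal (sub_nonneg.2 (Real.sigmoid_le_one _)), smul_eq_mul, smul_eq_mul]

theorem integral_groupSign : ∫ g, groupSign g ∂groupKernel θ z = groupBias (z ⬝ᵥ θ) := by
  rw [integral_groupKernel, groupBias]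
  simp only [groupSign, Matrix.cons_val_zero, Matrix.cons_val_one]
  ring

theorem groupSign_classify_mul_groupBias :
    groupSign (classify θ z) * groupBias (z ⬝ᵥ θ) = |groupBias (z ⬝ᵥ θ)| := by
  unfold classify groupBias
  split_ifs with h
  · rw [abs_of_nonneg (by linarith)]
    simp [groupSign]
  · rw [abs_of_neg (by linarith)]
    simp [groupSign]

@[fun_prop]
theorem measurable_classify (θ : Fin d → ℝ) : Measurable (classify θ) :=
  Measurable.ite (measurableSet_le measurable_const
    (continuous_sigmoid.measurable.comp (measurable_dotProduct_left θ)))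
    measurable_const measurable_const

end GroupKernel

/-! ### Relative entropy of the interaction -/

section InteractionEntropy

variable {K d : ℕ}

theorem lintegral_latentLaw (μ : Instance K d) (σ : ℝ≥0)
    {f : Ctx K d × Fin 2 × ℝ → ℝ≥0∞} (hf : Measurable f) :
    ∫⁻ w, f w ∂μ.latentLaw σ = ∫⁻ c, ∫⁻ g, ∫⁻ ε, f (c, g, ε) ∂gaussianReal 0 (σ ^ 2)
      ∂groupKernel μ.θ c.2 ∂μ.ctxLaw := by
  rw [Instance.latentLaw, Measure.lintegral_compProd hf]
  refine lintegral_congr fun c => ?_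
  exact Kernel.lintegral_prod _ _ _ (hf.comp measurable_prodMk_left)

theorem latentLaw_eq_withDensity {μ₁ μ₂ : Instance K d} (hctx : μ₁.ctxLaw = μ₂.ctxLaw)
    (hθ : μ₂.θ = 0) (σ : ℝ≥0) :
    μ₁.latentLaw σ = (μ₂.latentLaw σ).withDensity fun w =>
      ENNReal.ofReal (1 + groupSign w.2.1 * groupBias (w.1.2 ⬝ᵥ μ₁.θ)) := by
  have hm : Measurable fun w : Ctx K d × Fin 2 × ℝ =>
      ENNReal.ofReal (1 + groupSign w.2.1 * groupBias (w.1.2 ⬝ᵥ μ₁.θ)) := by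
    fun_prop
  refine Measure.ext_of_lintegral _ fun f hf => ?_
  rw [lintegral_withDensity_eq_lintegral_mul _ hm hf, lintegral_latentLaw _ _ hf,
    lintegral_latentLaw _ _ (hm.mul hf), hctx]
  refine lintegral_congr fun c => ?_
  have hm' (g : Fin 2) : Measurable fun ε : ℝ => f (c, g, ε) :=
    hf.comp (measurable_prodMk_left.comp measurable_prodMk_left)
  have hhalf (p : ℝ) : ENNReal.ofReal p = ENNReal.ofReal 2⁻¹ * ENNReal.ofReal (2 * p) := by
    rw [← ENNReal.ofReal_mul (by norm_num), inv_mul_cancel_left₀ two_ne_zero]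
  simp only [lintegral_groupKernel, Pi.mul_apply, lintegral_const_mul _ (hm' _), hθ,
    dotProduct_zero, Real.sigmoid_zero, ← mul_assoc]
  rw [show (1 : ℝ) - 2⁻¹ = 2⁻¹ by norm_num, hhalf (Real.sigmoid _),
    hhalf (1 - Real.sigmoid _), groupBias, groupSign]
  congr 5 <;> (simp only [Matrix.cons_val_zero, Matrix.cons_val_one]; ring)

theorem klDiv_latentLaw_le {μ₁ μ₂ : Instance K d} (hθ : μ₂.θ = 0) (σ : ℝ≥0) :
    klDiv (μ₁.latentLaw σ) (μ₂.latentLaw σ) ≤ klDiv μ₁.ctxLaw μ₂.ctxLaw +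
      ∫⁻ z, ENNReal.ofReal ((z ⬝ᵥ μ₁.θ) ^ 2) ∂μ₁.zLaw := by
  set μ₀ : Instance K d := { μ₁ with θ := 0 } with hμ₀
  have hlabel : klDiv (μ₁.latentLaw σ) (μ₀.latentLaw σ) ≤
      ∫⁻ z, ENNReal.ofReal ((z ⬝ᵥ μ₁.θ) ^ 2) ∂μ₁.zLaw := by
    have hsq (g : Fin 2) (u : ℝ) : (1 + groupSign g * groupBias u - 1) ^ 2 ≤ u ^ 2 := by
      refine sq_le_sq.2 ?_
      rw [add_sub_cancel_left, abs_mul, abs_groupSign, one_mul]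
      exact abs_groupBias_le u
    have hdensity := latentLaw_eq_withDensity (μ₁ := μ₁) (μ₂ := μ₀) rfl rfl σ
    refine (klDiv_withDensity_le (by fun_prop) (fun w => ?_) hdensity).trans ?_
    · have := abs_groupBias_le_one (w.1.2 ⬝ᵥ μ₁.θ)
      have := neg_abs_le (groupSign w.2.1 * groupBias (w.1.2 ⬝ᵥ μ₁.θ))
      rw [abs_mul, abs_groupSign, one_mul] at this
      simp only [Pi.zero_apply]
      linarith
    · rw [lintegral_latentLaw _ _ (by fun_prop), Instance.zLaw,
        lintegral_map (by fun_prop) measurable_snd]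
      refine lintegral_mono fun c => ?_
      refine (lintegral_mono fun g => lintegral_mono fun _ =>
        ENNReal.ofReal_le_ofReal (hsq g (c.2 ⬝ᵥ μ₁.θ))).trans_eq ?_
      simp
  calc klDiv (μ₁.latentLaw σ) (μ₂.latentLaw σ)
      = klDiv μ₁.ctxLaw μ₂.ctxLaw + klDiv (μ₁.latentLaw σ) (μ₀.latentLaw σ) := by
        simp only [Instance.latentLaw, hθ, hμ₀]
        exact klDiv_compProd_eq_add _ _ _ _
    _ ≤ _ := by gcongr

theorem klDiv_histLaw_le {μ₁ μ₂ : Instance K d} (hβ : μ₁.β = μ₂.β) (σ : ℝ≥0) (π : Policy K d)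
    (n : ℕ) :
    klDiv (histLaw μ₁ σ π n) (histLaw μ₂ σ π n) ≤
      n * klDiv (μ₁.latentLaw σ) (μ₂.latentLaw σ) := by
  induction n with
  | zero => simp [histLaw]
  | succ n ih =>
    have hobserve : observe μ₁ = observe μ₂ := by
      funext w
      simp only [observe, Instance.meanReward, hβ]
    rw [histLaw, histLaw, hobserve]
    refine (klDiv_map_le _ _ (measurable_snoc_observe μ₂ n)).trans ?_
    rw [roundKernel, roundKernel, ← Measure.compProd_assoc', ← Measure.compProd_assoc']
    refine (klDiv_map_le _ _ MeasurableEquiv.prodAssoc.measurable).trans ?_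
    rw [klDiv_compProd_left, Measure.compProd_const, Measure.compProd_const, klDiv_prod]
    push_cast
    rw [add_mul, one_mul]
    gcongr

end InteractionEntropy

/-! ### Second moments -/

section SecondMoment

variable {Ω : Type*} [MeasurableSpace Ω] {P : Measure Ω} {d : ℕ} {X : Ω → Fin d → ℝ}

theorem dotProduct_secondMoment_mulVec (hX : ∀ i j, Integrable (fun ω => X ω i * X ω j) P)
    (w : Fin d → ℝ) :
    w ⬝ᵥ (secondMoment P X).mulVec w = ∫ ω, (X ω ⬝ᵥ w) ^ 2 ∂P := by
  have hexpand (ω : Ω) : (X ω ⬝ᵥ w) ^ 2 = ∑ i, ∑ j, w i * (X ω i * X ω j * w j) := by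
    rw [sq, dotProduct, Finset.sum_mul_sum]
    exact Finset.sum_congr rfl fun i _ => Finset.sum_congr rfl fun j _ => by ring
  have hint (i j : Fin d) : Integrable (fun ω => w i * (X ω i * X ω j * w j)) P :=
    ((hX i j).mul_const _).const_mul _
  simp only [hexpand]
  rw [integral_finsetSum _ fun i _ => integrable_finsetSum _ fun j _ => hint i j]
  simp only [integral_finsetSum _ fun j _ => hint _ j, integral_const_mul, integral_mul_const,
    dotProduct, Matrix.mulVec, Finset.mul_sum, secondMoment, Matrix.of_apply]

theorem sum_sq_pos {ι : Type*} [Fintype ι] {w : ι → ℝ} (hw : w ≠ 0) : 0 < ∑ i, w i ^ 2 := by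
  obtain ⟨i, hi⟩ := Function.ne_iff.1 hw
  exact Finset.sum_pos' (fun j _ => sq_nonneg _) ⟨i, Finset.mem_univ i, sq_pos_of_ne_zero hi⟩

theorem eigenvaluesWithin_of_forall_dotProduct_mulVec {M : ℝ} {S : Matrix (Fin d) (Fin d) ℝ}
    (h : ∀ w : Fin d → ℝ, w ≠ 0 →
      1 / M * ∑ i, w i ^ 2 < w ⬝ᵥ S.mulVec w ∧ w ⬝ᵥ S.mulVec w < M * ∑ i, w i ^ 2) :
    EigenvaluesWithin M S := by
  intro l hl
  obtain ⟨w, hw⟩ := hl.exists_hasEigenvector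
  have hquad : w ⬝ᵥ S.mulVec w = l * ∑ i, w i ^ 2 := by
    rw [show S.mulVec w = l • w by simpa using hw.apply_eq_smul, dotProduct_smul, smul_eq_mul]
    simp only [dotProduct, sq]
  have hpos := sum_sq_pos hw.2
  simpa only [hquad, mul_lt_mul_iff_left₀ hpos] using h w hw.2

end SecondMoment

/-! ### Moments of sub-Gaussian variables -/

section SubGaussian

variable {Ω : Type*} [MeasurableSpace Ω] {P : Measure Ω} {X : Ω → ℝ} {c : ℝ≥0}

theorem lintegral_exp_sq_div_four_gaussianReal :
    ∫⁻ g, ENNReal.ofReal (Real.exp (g ^ 2 / 4)) ∂gaussianReal 0 1 = ENNReal.ofReal √2 := by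
  rw [gaussianReal_of_var_ne_zero _ one_ne_zero,
    lintegral_withDensity_eq_lintegral_mul _ (measurable_gaussianPDF _ _) (by fun_prop)]
  have hdensity (g : ℝ) :
      (gaussianPDF 0 1 * fun g => ENNReal.ofReal (Real.exp (g ^ 2 / 4))) g =
        ENNReal.ofReal ((√(2 * Real.pi))⁻¹ * Real.exp (-(1 / 4) * g ^ 2)) := by
    rw [Pi.mul_apply, gaussianPDF, ← ENNReal.ofReal_mul (gaussianPDFReal_nonneg _ _ _),
      gaussianPDFReal, mul_assoc, ← Real.exp_add]
    simp only [NNReal.coe_one, mul_one, sub_zero]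
    ring_nf
  simp only [hdensity]
  rw [← ofReal_integral_eq_lintegral_ofReal
    ((integrable_exp_neg_mul_sq (by norm_num)).const_mul _) (ae_of_all _ fun g => by positivity),
    integral_const_mul, integral_gaussian, ← Real.sqrt_inv, ← Real.sqrt_mul (by positivity)]
  congr 2
  field_simp
  norm_num

theorem lintegral_exp_mul_gaussianReal (t : ℝ) :
    ∫⁻ g, ENNReal.ofReal (Real.exp (t * g)) ∂gaussianReal 0 1 =
      ENNReal.ofReal (Real.exp (t ^ 2 / 2)) := by
  rw [← ofReal_integral_eq_lintegral_ofReal (integrable_exp_mul_gaussianReal _)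
    (ae_of_all _ fun g => (Real.exp_pos _).le)]
  simpa [mgf] using congrArg ENNReal.ofReal
    (congrFun (mgf_id_gaussianReal (μ := 0) (v := 1)) t)

/- The square in the exponent is linearised by an independent standard Gaussian variable. -/
theorem lintegral_exp_sq_div_le (hX : HasSubgaussianMGF X c P) [SFinite P] :
    ∫⁻ ω, ENNReal.ofReal (Real.exp (X ω ^ 2 / (4 * c))) ∂P ≤ ENNReal.ofReal √2 := by
  have hlinear (y : ℝ) : ENNReal.ofReal (Real.exp (y ^ 2 / (4 * c))) =
      ∫⁻ g, ENNReal.ofReal (Real.exp (y / √(2 * c) * g)) ∂gaussianReal 0 1 := by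
    rw [lintegral_exp_mul_gaussianReal, div_pow, Real.sq_sqrt (by positivity)]
    congr 2
    ring
  have hexponent (g : ℝ) : c * (g / √(2 * c)) ^ 2 / 2 ≤ g ^ 2 / 4 := by
    rw [div_pow, Real.sq_sqrt (by positivity)]
    rcases eq_or_ne c 0 with rfl | hc
    · simpa using by positivity
    · exact le_of_eq (by field_simp; norm_num)
  have hmeas : AEMeasurable (fun p : Ω × ℝ => X p.1) (P.prod (gaussianReal 0 1)) :=
    hX.aemeasurable.comp_fst
  simp only [hlinear]
  rw [lintegral_lintegral_swap
    (((hmeas.div_const _).mul measurable_snd.aemeasurable).exp.ennreal_ofReal)]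
  refine (lintegral_mono fun g => ?_).trans lintegral_exp_sq_div_four_gaussianReal.le
  simp only [fun ω => div_mul_comm (X ω) √(2 * (c : ℝ)) g]
  rw [← ofReal_integral_eq_lintegral_ofReal (hX.integrable_exp_mul _)
    (ae_of_all _ fun ω => (Real.exp_pos _).le)]
  exact ENNReal.ofReal_le_ofReal
    ((hX.mgf_le _).trans (Real.exp_le_exp.2 (hexponent g)))

theorem integrable_exp_sq_div (hX : HasSubgaussianMGF X c P) [SFinite P] :
    Integrable (fun ω => Real.exp (X ω ^ 2 / (4 * c))) P :=
  ⟨((hX.aemeasurable.pow_const 2).div_const _).exp.aestronglyMeasurable,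
    (hasFiniteIntegral_iff_ofReal (ae_of_all _ fun _ => (Real.exp_pos _).le)).2
      ((lintegral_exp_sq_div_le hX).trans_lt ENNReal.ofReal_lt_top)⟩

theorem integral_exp_sq_div_le (hX : HasSubgaussianMGF X c P) [SFinite P] :
    ∫ ω, Real.exp (X ω ^ 2 / (4 * c)) ∂P ≤ √2 := by
  have h := lintegral_exp_sq_div_le hX
  rwa [← ofReal_integral_eq_lintegral_ofReal (integrable_exp_sq_div hX)
    (ae_of_all _ fun _ => (Real.exp_pos _).le),
    ENNReal.ofReal_le_ofReal_iff (by positivity)] at h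

theorem integrable_pow_of_hasSubgaussianMGF (hX : HasSubgaussianMGF X c P) (n : ℕ) :
    Integrable (fun ω => X ω ^ n) P :=
  integrable_pow_of_mem_interior_integrableExpSet (by simp [hX.integrableExpSet_eq_univ]) n

theorem integral_pow_four_le [IsProbabilityMeasure P] (hX : HasSubgaussianMGF X c P)
    (hc : c ≠ 0) (hsq : ∫ ω, X ω ^ 2 ∂P = c) : ∫ ω, X ω ^ 4 ∂P ≤ 6 * c ^ 2 := by
  have hpointwise (y : ℝ) :
      y ^ 4 ≤ 32 * c ^ 2 * (Real.exp (y ^ 2 / (4 * c)) - 1) - 8 * c * y ^ 2 := by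
    calc y ^ 4 = 32 * c ^ 2 * (y ^ 2 / (4 * c) + (y ^ 2 / (4 * c)) ^ 2 / 2) - 8 * c * y ^ 2 := by
          field_simp
          ring
      _ ≤ _ := by
          gcongr
          linarith [Real.quadratic_le_exp_of_nonneg (x := y ^ 2 / (4 * c)) (by positivity)]
  have hexp := integrable_exp_sq_div hX
  have hexp_sub : Integrable
      (fun ω => 32 * c ^ 2 * (Real.exp (X ω ^ 2 / (4 * c)) - 1)) P :=
    (hexp.sub (integrable_const 1)).const_mul _
  have hsq_int := integrable_pow_of_hasSubgaussianMGF hX 2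
  calc ∫ ω, X ω ^ 4 ∂P
      ≤ ∫ ω, (32 * c ^ 2 * (Real.exp (X ω ^ 2 / (4 * c)) - 1) - 8 * c * X ω ^ 2) ∂P :=
        integral_mono (integrable_pow_of_hasSubgaussianMGF hX 4)
          (hexp_sub.sub (hsq_int.const_mul _)) fun ω => hpointwise (X ω)
    _ = 32 * c ^ 2 * (∫ ω, Real.exp (X ω ^ 2 / (4 * c)) ∂P - 1) - 8 * c ^ 2 := by
        rw [integral_sub hexp_sub (hsq_int.const_mul _),
          integral_const_mul, integral_const_mul, integral_sub hexp (integrable_const 1), hsq]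
        simp only [integral_const, probReal_univ, smul_eq_mul]
        ring
    _ ≤ 32 * c ^ 2 * (1.4375 - 1) - 8 * c ^ 2 := by
        have hsqrt : √2 ≤ 1.4375 := Real.sqrt_le_iff.2 (by norm_num)
        gcongr
        exact (integral_exp_sq_div_le hX).trans hsqrt
    _ = 6 * c ^ 2 := by ring

/- Khinchine's inequality; `y² / 2 - y⁴ / 54 ≤ y` for `y ≥ 0` with equality at `y = 3`. -/
theorem sqrt_div_three_le_integral_abs [IsProbabilityMeasure P] (hX : HasSubgaussianMGF X c P)
    (hsq : ∫ ω, X ω ^ 2 ∂P = c) : √c / 3 ≤ ∫ ω, |X ω| ∂P := by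
  rcases eq_or_ne c 0 with rfl | hc
  · simpa using integral_nonneg fun ω => abs_nonneg (X ω)
  have hc0 : 0 < √(c : ℝ) := Real.sqrt_pos.2 (by positivity)
  have hcsq : √(c : ℝ) ^ 2 = c := Real.sq_sqrt c.2
  have hpointwise (y : ℝ) : y ^ 2 / (2 * √c) - y ^ 4 / (54 * √c ^ 3) ≤ |y| := by
    rw [← sq_abs, ← Even.pow_abs (n := 4) ⟨2, rfl⟩, sub_le_iff_le_add, ← sub_nonneg]
    have hfactor : |y| + |y| ^ 4 / (54 * √c ^ 3) - |y| ^ 2 / (2 * √c) =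
        |y| * (|y| - 3 * √c) ^ 2 * (|y| + 6 * √c) / (54 * √c ^ 3) := by
      field_simp
      ring
    rw [hfactor]
    positivity
  have hint2 := (integrable_pow_of_hasSubgaussianMGF hX 2).div_const (2 * √c)
  have hint4 := (integrable_pow_of_hasSubgaussianMGF hX 4).div_const (54 * √c ^ 3)
  calc √c / 3 ≤ √c ^ 2 / (2 * √c) - 6 * (√c ^ 2) ^ 2 / (54 * √c ^ 3) := by
        field_simp
        norm_num
    _ ≤ (∫ ω, X ω ^ 2 ∂P) / (2 * √c) - (∫ ω, X ω ^ 4 ∂P) / (54 * √c ^ 3) := by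
        rw [hcsq, hsq]
        gcongr
        exact integral_pow_four_le hX hc hsq
    _ = ∫ ω, (X ω ^ 2 / (2 * √c) - X ω ^ 4 / (54 * √c ^ 3)) ∂P := by
        rw [integral_sub hint2 hint4, integral_div, integral_div]
    _ ≤ ∫ ω, |X ω| ∂P := integral_mono (hint2.sub hint4) hX.integrable.abs fun ω => hpointwise _

end SubGaussian

/-! ### Random signs -/

/-- The law of a fair random sign. -/
def rademacher : Measure ℝ := (2⁻¹ : ℝ≥0∞) • (Measure.dirac 1 + Measure.dirac (-1))

instance : IsProbabilityMeasure rademacher := ⟨by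
  simp [rademacher, ENNReal.inv_two_add_inv_two]⟩

theorem ae_rademacher_abs : ∀ᵐ r ∂rademacher, |r| = 1 := by
  refine Measure.ae_smul_measure (ae_add_measure_iff.2 ⟨?_, ?_⟩) _ <;>
    simp [ae_dirac_eq]

theorem integral_id_rademacher : ∫ r, r ∂rademacher = 0 := by
  rw [rademacher, integral_smul_measure, integral_add_measure (integrable_dirac (by simp))
    (integrable_dirac (by simp)), integral_dirac, integral_dirac, add_neg_cancel, smul_zero]

/-- The law of a vector of `d` independent fair signs. -/
def signLaw (d : ℕ) : Measure (Fin d → ℝ) := Measure.pi fun _ => rademacher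

section SignLaw

variable {d : ℕ}

instance : IsProbabilityMeasure (signLaw d) := by unfold signLaw; infer_instance

theorem measurePreserving_eval_signLaw (j : Fin d) :
    MeasurePreserving (fun r : Fin d → ℝ => r j) (signLaw d) rademacher :=
  measurePreserving_eval (fun _ => rademacher) j

theorem ae_signLaw_abs : ∀ᵐ r ∂signLaw d, ∀ j, |r j| = 1 :=
  ae_all_iff.2 fun j =>
    (measurePreserving_eval_signLaw j).quasiMeasurePreserving.ae ae_rademacher_abs

theorem integrable_signLaw {f : (Fin d → ℝ) → ℝ} (hf : Continuous f) :
    Integrable f (signLaw d) := by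
  obtain ⟨C, hC⟩ := (isCompact_closedBall (0 : Fin d → ℝ) 1).exists_bound_of_continuousOn
    hf.continuousOn
  refine Integrable.of_bound hf.aestronglyMeasurable C ?_
  filter_upwards [ae_signLaw_abs] with r hr
  refine hC r (mem_closedBall_zero_iff.2 ((pi_norm_le_iff_of_nonneg zero_le_one).2 fun j => ?_))
  rw [Real.norm_eq_abs, hr j]

theorem iIndepFun_eval_signLaw : iIndepFun (fun (j : Fin d) r => r j) (signLaw d) :=
  iIndepFun_pi (μ := fun _ : Fin d => rademacher) (X := fun _ => id) fun _ => aemeasurable_id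

theorem integral_eval_signLaw (j : Fin d) : ∫ r, r j ∂signLaw d = 0 := by
  rw [← integral_id_rademacher, ← (measurePreserving_eval_signLaw j).map_eq]
  exact (integral_map (measurePreserving_eval_signLaw j).aemeasurable
    aestronglyMeasurable_id).symm

theorem secondMoment_signLaw : secondMoment (signLaw d) id = 1 := by
  ext i j
  simp only [secondMoment, Matrix.of_apply, id, Matrix.one_apply]
  split_ifs with hij
  · have hsq : ∀ᵐ r ∂signLaw d, r i * r j = 1 := by
      filter_upwards [ae_signLaw_abs] with r hr
      rw [hij, ← abs_mul_abs_self, hr j, one_mul]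
    rw [integral_congr_ae hsq, integral_const, probReal_univ, one_smul]
  · rw [(iIndepFun_eval_signLaw.indepFun hij).integral_fun_mul_eq_mul_integral
      (measurable_pi_apply i).aestronglyMeasurable (measurable_pi_apply j).aestronglyMeasurable,
      integral_eval_signLaw, zero_mul]

theorem integral_signLaw_sq (u : Fin d → ℝ) :
    ∫ r, (r ⬝ᵥ u) ^ 2 ∂signLaw d = ∑ i, u i ^ 2 := by
  have h := dotProduct_secondMoment_mulVec (X := id)
    (fun i j => integrable_signLaw (by simp only [id]; fun_prop)) u
  rw [secondMoment_signLaw, Matrix.one_mulVec] at h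
  simpa only [id, dotProduct, ← sq] using h.symm

theorem hasSubgaussianMGF_signLaw (u : Fin d → ℝ) :
    HasSubgaussianMGF (fun r => r ⬝ᵥ u) (∑ i, ‖u i‖₊ ^ 2) (signLaw d) := by
  refine HasSubgaussianMGF.sum_of_iIndepFun
    (iIndepFun_eval_signLaw.comp (fun i x => x * u i) fun i => by fun_prop) fun i _ => ?_
  have hbound : ∀ᵐ r ∂signLaw d, r i * u i ∈ Set.Icc (-|u i|) |u i| := by
    filter_upwards [ae_signLaw_abs] with r hr
    rw [Set.mem_Icc, ← abs_le, abs_mul, hr i, one_mul]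
  have hmean : ∫ r, r i * u i ∂signLaw d = 0 := by
    rw [integral_mul_const, integral_eval_signLaw, zero_mul]
  convert hasSubgaussianMGF_of_mem_Icc_of_integral_eq_zero
    (measurable_pi_apply i |>.mul_const _).aemeasurable hbound hmean using 1
  · rfl
  · ext
    simp [← two_mul]

theorem coe_sum_nnnorm_sq (u : Fin d → ℝ) : ((∑ i, ‖u i‖₊ ^ 2 : ℝ≥0) : ℝ) = ∑ i, u i ^ 2 := by
  push_cast
  simp only [Real.norm_eq_abs, sq_abs]

theorem sqrt_div_three_le_integral_signLaw_abs (u : Fin d → ℝ) :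
    √(∑ i, u i ^ 2) / 3 ≤ ∫ r, |r ⬝ᵥ u| ∂signLaw d := by
  rw [← coe_sum_nnnorm_sq]
  exact sqrt_div_three_le_integral_abs (hasSubgaussianMGF_signLaw u)
    ((integral_signLaw_sq u).trans (coe_sum_nnnorm_sq u).symm)

theorem integrable_signLaw_mul {f g : (Fin d → ℝ) → ℝ} (hg : Continuous g) (hf : Measurable f)
    (hf1 : ∀ r, |f r| ≤ 1) : Integrable (fun r => g r * f r) (signLaw d) :=
  (integrable_signLaw hg).mul_bdd (c := 1) hf.aestronglyMeasurable (ae_of_all _ hf1)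

/- Bessel's inequality for the orthonormal coordinate functions. -/
theorem sum_integral_signLaw_mul_sq_le_one {f : (Fin d → ℝ) → ℝ} (hf : Measurable f)
    (hf1 : ∀ r, |f r| ≤ 1) : ∑ j, (∫ r, r j * f r ∂signLaw d) ^ 2 ≤ 1 := by
  set m : Fin d → ℝ := fun j => ∫ r, r j * f r ∂signLaw d with hm
  have hlin : Integrable (fun r => (r ⬝ᵥ m) * f r) (signLaw d) :=
    integrable_signLaw_mul (by fun_prop) hf hf1
  have hsq : Integrable (fun r => (r ⬝ᵥ m) ^ 2) (signLaw d) := integrable_signLaw (by fun_prop)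
  have hinner : ∫ r, (r ⬝ᵥ m) * f r ∂signLaw d = ∑ j, m j ^ 2 := by
    simp only [dotProduct, Finset.sum_mul, mul_right_comm _ (m _)]
    rw [integral_finsetSum _ fun j _ =>
      (integrable_signLaw_mul (by fun_prop) hf hf1).mul_const _]
    simp only [integral_mul_const, sq, hm]
  have hproj : ∫ r, (2 * ((r ⬝ᵥ m) * f r) - (r ⬝ᵥ m) ^ 2) ∂signLaw d ≤ ∫ _, 1 ∂signLaw d := by
    refine integral_mono ((hlin.const_mul 2).sub hsq) (integrable_const _) fun r => ?_
    have hf_sq : f r ^ 2 ≤ 1 := (sq_le_one_iff_abs_le_one _).2 (hf1 r)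
    dsimp only
    nlinarith [sq_nonneg (r ⬝ᵥ m - f r)]
  rw [integral_sub (hlin.const_mul 2) hsq, integral_const_mul, hinner, integral_signLaw_sq,
    integral_const, probReal_univ, one_smul] at hproj
  linarith

end SignLaw

/-! ### Conditioning on a likely event -/

section Conditioning

variable {Ω : Type*} [MeasurableSpace Ω] {P : Measure Ω} {S : Set Ω}

theorem integral_cond (f : Ω → ℝ) : ∫ ω, f ω ∂P[|S] = (P.real S)⁻¹ * ∫ ω in S, f ω ∂P := by
  rw [ProbabilityTheory.cond, integral_smul_measure, ENNReal.toReal_inv, smul_eq_mul,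
    measureReal_def]

theorem integrable_cond {f : Ω → ℝ} (hf : Integrable f P) (hS : P S ≠ 0) :
    Integrable f P[|S] :=
  hf.restrict.smul_measure (ENNReal.inv_ne_top.2 hS)

theorem integral_cond_le {f : Ω → ℝ} (hf : Integrable f P) (hf0 : 0 ≤ f) :
    ∫ ω, f ω ∂P[|S] ≤ (P.real S)⁻¹ * ∫ ω, f ω ∂P := by
  rw [integral_cond]
  gcongr
  · exact ae_of_all _ hf0
  · exact Measure.restrict_le_self

theorem lintegral_cond_le (f : Ω → ℝ≥0∞) : ∫⁻ ω, f ω ∂P[|S] ≤ (P S)⁻¹ * ∫⁻ ω, f ω ∂P := by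
  rw [ProbabilityTheory.cond, lintegral_smul_measure, smul_eq_mul]
  gcongr
  exact Measure.restrict_le_self

variable [IsProbabilityMeasure P]

theorem setIntegral_le_integral_cond {f : Ω → ℝ} (hf0 : 0 ≤ f) (hS : P S ≠ 0) :
    ∫ ω in S, f ω ∂P ≤ ∫ ω, f ω ∂P[|S] := by
  rw [integral_cond]
  exact le_mul_of_one_le_left (integral_nonneg hf0)
    ((one_le_inv₀ (ENNReal.toReal_pos hS (measure_ne_top _ _))).2 measureReal_le_one)

theorem half_le_integral_cond_sq {X : Ω → ℝ} {c : ℝ≥0} (hX : HasSubgaussianMGF X c P)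
    (hc : c ≠ 0) (hsq : ∫ ω, X ω ^ 2 ∂P = c) (hS : MeasurableSet S) (hS' : 23 / 24 ≤ P.real S) :
    c / 2 ≤ ∫ ω, X ω ^ 2 ∂P[|S] := by
  have hint2 := integrable_pow_of_hasSubgaussianMGF hX 2
  have hint4 := integrable_pow_of_hasSubgaussianMGF hX 4
  have hcompl : P.real Sᶜ ≤ 1 / 24 := by
    rw [probReal_compl_eq_one_sub hS]
    linarith
  have hpointwise (y : ℝ) : y ^ 2 ≤ 6 * c + y ^ 4 / (24 * c) := by
    have : 6 * c + y ^ 4 / (24 * c) - y ^ 2 = (y ^ 2 - 12 * c) ^ 2 / (24 * c) := by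
      field_simp
      ring
    rw [← sub_nonneg, this]
    positivity
  have htail : ∫ ω in Sᶜ, X ω ^ 2 ∂P ≤ c / 2 := by
    calc ∫ ω in Sᶜ, X ω ^ 2 ∂P
        ≤ ∫ ω in Sᶜ, (6 * c + X ω ^ 4 / (24 * c)) ∂P :=
          integral_mono hint2.restrict ((integrable_const _).add (hint4.restrict.div_const _))
            fun ω => hpointwise (X ω)
      _ = P.real Sᶜ * (6 * c) + (∫ ω in Sᶜ, X ω ^ 4 ∂P) / (24 * c) := by
          rw [integral_add (integrable_const _) (hint4.restrict.div_const _), setIntegral_const,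
            smul_eq_mul, integral_div]
      _ ≤ 1 / 24 * (6 * c) + 6 * c ^ 2 / (24 * c) := by
          gcongr
          exact (setIntegral_le_integral hint4 (ae_of_all _ fun ω => by positivity)).trans
            (integral_pow_four_le hX hc hsq)
      _ = c / 2 := by
          field_simp
          norm_num
  have hP : P S ≠ 0 := fun h => by simp [measureReal_def, h] at hS'; norm_num at hS'
  have hsplit := integral_add_compl hS hint2
  rw [hsq] at hsplit
  linarith [setIntegral_le_integral_cond (f := fun ω => X ω ^ 2) (fun ω => sq_nonneg _) hP]

theorem lintegral_cond_exp_sq_div_le {X : Ω → ℝ} {c : ℝ≥0} (hX : HasSubgaussianMGF X c P)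
    (hS : 23 / 24 ≤ P.real S) :
    ∫⁻ ω, ENNReal.ofReal (Real.exp (X ω ^ 2 / (4 * c))) ∂P[|S] ≤ 2 := by
  have hpos : 0 < P.real S := by linarith
  have hsqrt : √2 ≤ 1.5 := Real.sqrt_le_iff.2 (by norm_num)
  calc ∫⁻ ω, ENNReal.ofReal (Real.exp (X ω ^ 2 / (4 * c))) ∂P[|S]
      ≤ (P S)⁻¹ * ENNReal.ofReal √2 :=
        (lintegral_cond_le _).trans (by gcongr; exact lintegral_exp_sq_div_le hX)
    _ = ENNReal.ofReal ((P.real S)⁻¹ * √2) := by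
        rw [ENNReal.ofReal_mul (by positivity), ENNReal.ofReal_inv_of_pos hpos, ofReal_measureReal]
    _ ≤ ENNReal.ofReal ((23 / 24)⁻¹ * 1.5) := by gcongr
    _ ≤ 2 := ENNReal.ofReal_le_of_le_toReal (by norm_num)

section Truncation

variable {X : Ω → ℝ} {b : ℝ}

theorem measurableSet_abs_le (hX : Measurable X) (b : ℝ) : MeasurableSet {ω | |X ω| ≤ b} :=
  measurableSet_le hX.abs measurable_const

theorem measureReal_compl_abs_le_le (hX : Integrable (fun ω => X ω ^ 2) P) (hb : 0 < b) :
    P.real {ω | |X ω| ≤ b}ᶜ ≤ (∫ ω, X ω ^ 2 ∂P) / b ^ 2 := by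
  rw [le_div_iff₀ (by positivity), mul_comm]
  refine le_trans ?_
    (mul_meas_ge_le_integral_of_nonneg (ae_of_all _ fun ω => sq_nonneg _) hX (b ^ 2))
  refine mul_le_mul_of_nonneg_left (measureReal_mono fun ω hω => ?_) (by positivity)
  simp only [Set.mem_compl_iff, Set.mem_ofPred_eq, not_le] at hω ⊢
  rw [← sq_abs (X ω)]
  gcongr

/- Outside the truncation event the integrand is at most `2|X| ≤ 2X²/b`. -/
theorem integral_abs_sub_mul_sub_le_integral_cond (hXm : Measurable X)
    (hX : Integrable (fun ω => X ω ^ 2) P) (hb : 0 < b) (hP : P {ω | |X ω| ≤ b} ≠ 0) {f : Ω → ℝ}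
    (hf : Measurable f) (hf1 : ∀ ω, |f ω| ≤ 1) :
    ∫ ω, (|X ω| - X ω * f ω) ∂P - 2 / b * ∫ ω, X ω ^ 2 ∂P ≤
      ∫ ω, (|X ω| - X ω * f ω) ∂P[|{ω | |X ω| ≤ b}] := by
  have hS := measurableSet_abs_le hXm b
  have hmul (ω : Ω) : |X ω * f ω| ≤ |X ω| := by
    rw [abs_mul]
    exact mul_le_of_le_one_right (abs_nonneg _) (hf1 ω)
  have hX1 : Integrable X P :=
    ((memLp_two_iff_integrable_sq hXm.aestronglyMeasurable).2 hX).integrable one_le_two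
  have hint : Integrable (fun ω => |X ω| - X ω * f ω) P :=
    hX1.abs.sub (hX1.mul_bdd (c := 1) hf.aestronglyMeasurable (ae_of_all _ hf1))
  have htail : ∫ ω in {ω | |X ω| ≤ b}ᶜ, (|X ω| - X ω * f ω) ∂P ≤
      2 / b * ∫ ω, X ω ^ 2 ∂P := by
    rw [← integral_const_mul]
    refine (setIntegral_mono_on hint.integrableOn (hX.const_mul _).integrableOn hS.compl
      fun ω hω => ?_).trans (setIntegral_le_integral (hX.const_mul _)
        (ae_of_all _ fun ω => by positivity))
    have hlarge : |X ω| ≤ X ω ^ 2 / b := by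
      rw [Set.mem_compl_iff, Set.mem_ofPred_eq, not_le] at hω
      rw [le_div_iff₀ hb, ← sq_abs]
      nlinarith
    calc |X ω| - X ω * f ω ≤ 2 * |X ω| := by linarith [neg_abs_le (X ω * f ω), hmul ω]
      _ ≤ 2 * (X ω ^ 2 / b) := by gcongr
      _ = 2 / b * X ω ^ 2 := by ring
  linarith [integral_add_compl hS hint, setIntegral_le_integral_cond
    (fun ω => sub_nonneg.2 ((le_abs_self _).trans (hmul ω))) hP]

end Truncation

end Conditioning

/-! ### Random signs conditioned on a slab -/

/-- The law of a random sign vector `r` conditioned on the slab `|⟨r, θ⟩| ≤ b`. It is the law of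
the customer feature in the lower bound for the regular regret. -/
def slabLaw {d : ℕ} (θ : Fin d → ℝ) (b : ℝ) : Measure (Fin d → ℝ) :=
  (signLaw d)[|{r | |r ⬝ᵥ θ| ≤ b}]

section SlabLaw

variable {d : ℕ} {θ : Fin d → ℝ} {b : ℝ}

theorem signLaw_real_compl_slab_le (θ : Fin d → ℝ) (hb : 0 < b) :
    (signLaw d).real {r | |r ⬝ᵥ θ| ≤ b}ᶜ ≤ (∑ i, θ i ^ 2) / b ^ 2 := by
  rw [← integral_signLaw_sq]
  exact measureReal_compl_abs_le_le (integrable_signLaw (by fun_prop)) hb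

theorem le_signLaw_real_slab (hb : 0 < b) (hθ : 24 * ∑ i, θ i ^ 2 ≤ b ^ 2) :
    23 / 24 ≤ (signLaw d).real {r | |r ⬝ᵥ θ| ≤ b} := by
  have hcompl := signLaw_real_compl_slab_le θ hb
  rw [probReal_compl_eq_one_sub (measurableSet_abs_le (by fun_prop) b)] at hcompl
  have : (∑ i, θ i ^ 2) / b ^ 2 ≤ 1 / 24 := by
    rw [div_le_div_iff₀ (by positivity) (by norm_num)]
    linarith
  linarith

theorem signLaw_slab_ne_zero (hb : 0 < b) (hθ : 24 * ∑ i, θ i ^ 2 ≤ b ^ 2) :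
    signLaw d {r | |r ⬝ᵥ θ| ≤ b} ≠ 0 := fun h => by
  have := le_signLaw_real_slab hb hθ
  rw [measureReal_def, h, ENNReal.toReal_zero] at this
  norm_num at this

theorem isProbabilityMeasure_slabLaw (hb : 0 < b) (hθ : 24 * ∑ i, θ i ^ 2 ≤ b ^ 2) :
    IsProbabilityMeasure (slabLaw θ b) :=
  cond_isProbabilityMeasure (signLaw_slab_ne_zero hb hθ)

theorem integrable_slabLaw (hb : 0 < b) (hθ : 24 * ∑ i, θ i ^ 2 ≤ b ^ 2) {f : (Fin d → ℝ) → ℝ}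
    (hf : Continuous f) : Integrable f (slabLaw θ b) :=
  integrable_cond (integrable_signLaw hf) (signLaw_slab_ne_zero hb hθ)

theorem ae_slabLaw_abs_dotProduct_le : ∀ᵐ z ∂slabLaw θ b, |z ⬝ᵥ θ| ≤ b :=
  ae_cond_mem (measurableSet_abs_le (by fun_prop) b)

theorem integral_slabLaw_sq_le (hb : 0 < b) (hθ : 24 * ∑ i, θ i ^ 2 ≤ b ^ 2) (w : Fin d → ℝ) :
    ∫ z, (z ⬝ᵥ w) ^ 2 ∂slabLaw θ b ≤ 2 * ∑ i, w i ^ 2 := by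
  have hprob := le_signLaw_real_slab hb hθ
  refine (integral_cond_le (f := fun r => (r ⬝ᵥ w) ^ 2) (integrable_signLaw (by fun_prop))
    fun r => sq_nonneg _).trans ?_
  rw [integral_signLaw_sq]
  gcongr
  rw [inv_le_comm₀ (by linarith) two_pos]
  linarith

theorem isSubGaussian_slabLaw (hb : 0 < b) (hθ : 24 * ∑ i, θ i ^ 2 ≤ b ^ 2) :
    IsSubGaussian (slabLaw θ b) id 2 := by
  intro u hu
  have h := lintegral_cond_exp_sq_div_le (hasSubgaussianMGF_signLaw u)
    (le_signLaw_real_slab hb hθ)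
  rw [coe_sum_nnnorm_sq, hu] at h
  norm_num at h ⊢
  exact h

theorem eigenvaluesWithin_slabLaw (hb : 0 < b) (hθ : 24 * ∑ i, θ i ^ 2 ≤ b ^ 2) {M : ℝ}
    (hM : 4 ≤ M) : EigenvaluesWithin M (secondMoment (slabLaw θ b) id) := by
  refine eigenvaluesWithin_of_forall_dotProduct_mulVec fun w hw => ?_
  have hpos := sum_sq_pos hw
  have hlower : (∑ i, w i ^ 2) / 2 ≤ ∫ z, (z ⬝ᵥ w) ^ 2 ∂slabLaw θ b := by
    rw [← coe_sum_nnnorm_sq] at hpos ⊢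
    exact half_le_integral_cond_sq (hasSubgaussianMGF_signLaw w) (NNReal.coe_pos.1 hpos).ne'
      ((integral_signLaw_sq w).trans (coe_sum_nnnorm_sq w).symm)
      (measurableSet_abs_le (by fun_prop) b) (le_signLaw_real_slab hb hθ)
  have hM' : 1 / M ≤ 1 / 4 := one_div_le_one_div_of_le (by norm_num) hM
  rw [dotProduct_secondMoment_mulVec fun i j => by
    exact integrable_slabLaw (f := fun z => z i * z j) hb hθ (by fun_prop)]
  refine ⟨lt_of_lt_of_le ?_ hlower, (integral_slabLaw_sq_le hb hθ w).trans_lt ?_⟩ <;> nlinarith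

theorem klDiv_slabLaw_le (hb : 0 < b) (hθ : 24 * ∑ i, θ i ^ 2 ≤ b ^ 2) :
    klDiv (slabLaw θ b) (signLaw d) ≤ ENNReal.ofReal (2 * (∑ i, θ i ^ 2) / b ^ 2) := by
  have hprob := le_signLaw_real_slab hb hθ
  have hcompl := signLaw_real_compl_slab_le θ hb
  refine (klDiv_cond_le (measurableSet_abs_le (by fun_prop) b)
    (signLaw_slab_ne_zero hb hθ)).trans (ENNReal.ofReal_le_ofReal ?_)
  rw [mul_div_assoc, div_le_iff₀ (by linarith)]
  nlinarith [measureReal_nonneg (μ := signLaw d) (s := {r | |r ⬝ᵥ θ| ≤ b}ᶜ)]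

theorem le_integral_slabLaw_abs_sub_mul (hb : 0 < b) (hθ : 24 * ∑ i, θ i ^ 2 ≤ b ^ 2)
    {f : (Fin d → ℝ) → ℝ} (hf : Measurable f) (hf1 : ∀ r, |f r| ≤ 1) :
    √(∑ i, θ i ^ 2) / 3 - ∫ r, (r ⬝ᵥ θ) * f r ∂signLaw d - 2 * (∑ i, θ i ^ 2) / b ≤
      ∫ z, (|z ⬝ᵥ θ| - (z ⬝ᵥ θ) * f z) ∂slabLaw θ b := by
  have h := integral_abs_sub_mul_sub_le_integral_cond (P := signLaw d)
    (measurable_dotProduct_left θ) (integrable_signLaw (by fun_prop)) hb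
    (signLaw_slab_ne_zero hb hθ) hf hf1
  rw [integral_sub (integrable_signLaw (by fun_prop))
    (integrable_signLaw_mul (by fun_prop) hf hf1), integral_signLaw_sq] at h
  refine le_trans ?_ h
  rw [mul_div_right_comm]
  gcongr
  exact sqrt_div_three_le_integral_signLaw_abs θ

end SlabLaw

/-! ### Sub-Gaussian vectors -/

theorem exp_add_sq_div_le {s t κ : ℝ} (hs : 0 < s) (ht : 0 < t) (hκ : s + t ≤ κ) (x y : ℝ) :
    Real.exp ((x + y) ^ 2 / κ ^ 2) ≤ s / (s + t) * Real.exp (x ^ 2 / s ^ 2) +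
      t / (s + t) * Real.exp (y ^ 2 / t ^ 2) := by
  have hweighted : (x + y) ^ 2 / κ ^ 2 ≤
      s / (s + t) * (x ^ 2 / s ^ 2) + t / (s + t) * (y ^ 2 / t ^ 2) := by
    have hdiff : s / (s + t) * (x ^ 2 / s ^ 2) + t / (s + t) * (y ^ 2 / t ^ 2) -
        (x + y) ^ 2 / (s + t) ^ 2 = (x * t - y * s) ^ 2 / ((s + t) ^ 2 * s * t) := by
      field_simp
      ring
    calc (x + y) ^ 2 / κ ^ 2 ≤ (x + y) ^ 2 / (s + t) ^ 2 := by gcongr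
      _ ≤ _ := by
        rw [← sub_nonneg, hdiff]
        positivity
  refine (Real.exp_le_exp.2 hweighted).trans ?_
  exact convexOn_exp.2 (Set.mem_univ _) (Set.mem_univ _) (by positivity) (by positivity)
    (by field_simp)

namespace IsSubGaussian

variable {Ω ι ι' : Type*} [MeasurableSpace Ω] [Fintype ι] [Fintype ι'] {P : Measure Ω}
  {X : Ω → ι → ℝ} {Z : Ω → ι' → ℝ} {κ s t : ℝ}

theorem comp_measurePreserving {Ω' : Type*} [MeasurableSpace Ω'] {Q : Measure Ω'} {f : Ω' → Ω}
    (h : IsSubGaussian P X κ) (hX : Measurable X) (hf : MeasurePreserving f Q P) :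
    IsSubGaussian Q (fun ω => X (f ω)) κ := by
  intro u hu
  rw [hf.lintegral_comp (f := fun ω => ENNReal.ofReal (Real.exp ((X ω ⬝ᵥ u) ^ 2 / κ ^ 2)))
    (by fun_prop)]
  exact h u hu

theorem const_smul (h : IsSubGaussian P X κ) {a c : ℝ} (hc : 0 < c) (ha : |a| ≤ c) :
    IsSubGaussian P (fun ω => a • X ω) (c * κ) := by
  intro u hu
  refine (lintegral_mono fun ω => ENNReal.ofReal_le_ofReal (Real.exp_le_exp.2 ?_)).trans (h u hu)
  rw [smul_dotProduct, smul_eq_mul, mul_pow, mul_pow, mul_div_mul_comm, ← div_pow]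
  refine mul_le_of_le_one_left (by positivity) ?_
  rwa [sq_le_one_iff_abs_le_one, abs_div, abs_of_pos hc, div_le_one hc]

variable [IsProbabilityMeasure P]

theorem lintegral_le (h : IsSubGaussian P X κ) {u : ι → ℝ} (hu : ∑ i, u i ^ 2 ≤ 1) :
    ∫⁻ ω, ENNReal.ofReal (Real.exp ((X ω ⬝ᵥ u) ^ 2 / κ ^ 2)) ∂P ≤ 2 := by
  rcases eq_or_ne u 0 with rfl | hu0
  · simp
  have hpos := sum_sq_pos hu0
  have hunit : ∑ i, ((√(∑ i, u i ^ 2))⁻¹ • u) i ^ 2 = 1 := by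
    simp only [Pi.smul_apply, smul_eq_mul, mul_pow, ← Finset.mul_sum, inv_pow,
      Real.sq_sqrt hpos.le]
    exact inv_mul_cancel₀ hpos.ne'
  refine (lintegral_mono fun ω => ENNReal.ofReal_le_ofReal (Real.exp_le_exp.2 ?_)).trans
    (h _ hunit)
  rw [dotProduct_smul, smul_eq_mul, mul_pow, inv_pow, Real.sq_sqrt hpos.le]
  gcongr
  exact le_mul_of_one_le_left (sq_nonneg _) ((one_le_inv₀ hpos).2 hu)

theorem sumElim (hX : IsSubGaussian P X s) (hZ : IsSubGaussian P Z t) (hXm : Measurable X)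
    (hs : 0 < s) (ht : 0 < t) (hκ : s + t ≤ κ) :
    IsSubGaussian P (fun ω => Sum.elim (X ω) (Z ω)) κ := by
  intro u hu
  set v : ι → ℝ := fun i => u (Sum.inl i)
  set w : ι' → ℝ := fun i => u (Sum.inr i)
  rw [Fintype.sum_sum_type] at hu
  have hv : ∑ i, v i ^ 2 ≤ 1 := by
    linarith [Finset.sum_nonneg fun i (_ : i ∈ Finset.univ) => sq_nonneg (w i)]
  have hw : ∑ i, w i ^ 2 ≤ 1 := by
    linarith [Finset.sum_nonneg fun i (_ : i ∈ Finset.univ) => sq_nonneg (v i)]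
  have hsplit (ω : Ω) : ENNReal.ofReal (Real.exp ((Sum.elim (X ω) (Z ω) ⬝ᵥ u) ^ 2 / κ ^ 2)) ≤
      ENNReal.ofReal (s / (s + t)) * ENNReal.ofReal (Real.exp ((X ω ⬝ᵥ v) ^ 2 / s ^ 2)) +
      ENNReal.ofReal (t / (s + t)) * ENNReal.ofReal (Real.exp ((Z ω ⬝ᵥ w) ^ 2 / t ^ 2)) := by
    rw [← ENNReal.ofReal_mul (by positivity), ← ENNReal.ofReal_mul (by positivity),
      ← ENNReal.ofReal_add (by positivity) (by positivity),
      show Sum.elim (X ω) (Z ω) ⬝ᵥ u = X ω ⬝ᵥ v + Z ω ⬝ᵥ w from Fintype.sum_sum_type _]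
    exact ENNReal.ofReal_le_ofReal (exp_add_sq_div_le hs ht hκ _ _)
  refine (lintegral_mono hsplit).trans ?_
  rw [lintegral_add_left (by fun_prop), lintegral_const_mul' _ _ ENNReal.ofReal_ne_top,
    lintegral_const_mul' _ _ ENNReal.ofReal_ne_top]
  calc _ ≤ ENNReal.ofReal (s / (s + t)) * 2 + ENNReal.ofReal (t / (s + t)) * 2 := by
        gcongr
        exacts [hX.lintegral_le hv, hZ.lintegral_le hw]
    _ = 2 := by
        rw [← add_mul, ← ENNReal.ofReal_add (by positivity) (by positivity), ← add_div,
          div_self (by positivity), ENNReal.ofReal_one, one_mul]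

end IsSubGaussian

theorem isSubGaussian_signLaw (d : ℕ) : IsSubGaussian (signLaw d) id 2 := by
  intro u hu
  have h := lintegral_exp_sq_div_le (hasSubgaussianMGF_signLaw u)
  rw [coe_sum_nnnorm_sq, hu] at h
  norm_num at h ⊢
  exact h.trans (ENNReal.ofReal_le_of_le_toReal
    ((Real.sqrt_le_left two_pos.le).2 (by norm_num)))

/-! ### Bandits with parallel arms -/

section Argmax

variable {K : ℕ} [NeZero K]

theorem le_argmax (v : Fin K → ℝ) (j : Fin K) : v j ≤ v (argmax v) := by
  have := Finset.min'_mem (Finset.univ.filter fun k => ∀ j, v j ≤ v k) (by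
    obtain ⟨k, hk⟩ := Finite.exists_max v
    exact ⟨k, by simpa using hk⟩)
  exact (Finset.mem_filter.1 this).2 j

theorem argmax_eq_of_forall_lt {v : Fin K → ℝ} {a : Fin K} (h : ∀ k, k ≠ a → v k < v a) :
    argmax v = a := by
  by_contra hne
  exact (h _ hne).not_ge (le_argmax v a)

theorem iSup_eq_argmax (v : Fin K → ℝ) : ⨆ k, v k = v (argmax v) :=
  le_antisymm (ciSup_le (le_argmax v)) (le_ciSup (Set.finite_range v).bddAbove _)

end Argmax

section Arms

variable {K d : ℕ}

/-- The coefficient of arm `k` along the common direction of all arms: the first two arms are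
opposite, and the others are half the first one, so that they are never optimal. -/
def armCoeff (k : Fin K) : ℝ := if k.val = 0 then 1 else if k.val = 1 then -1 else 1 / 2

theorem abs_armCoeff_le (k : Fin K) : |armCoeff k| ≤ 1 := by
  unfold armCoeff
  split_ifs <;> norm_num [abs_le]

theorem armCoeff_sq_mem_Icc (k : Fin K) : armCoeff k ^ 2 ∈ Set.Icc (1 / 4 : ℝ) 1 := by
  unfold armCoeff
  split_ifs <;> norm_num

theorem exists_mul_armCoeff_eq_one (hK : 2 ≤ K) {s : ℝ} (hs : |s| = 1) :
    ∃ a : Fin K, s * armCoeff a = 1 ∧ ∀ k, k ≠ a → s * armCoeff k ≤ 1 / 2 := by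
  rcases eq_or_eq_neg_of_abs_eq hs with rfl | rfl
  · refine ⟨⟨0, by omega⟩, by norm_num [armCoeff], fun k hk => ?_⟩
    rw [armCoeff, if_neg (fun h => hk (Fin.ext h))]
    split_ifs <;> norm_num
  · refine ⟨⟨1, by omega⟩, by norm_num [armCoeff], fun k hk => ?_⟩
    rw [armCoeff, if_neg (c := k.val = 1) (fun h => hk (Fin.ext h))]
    split_ifs <;> norm_num

theorem argmax_mul_armCoeff [NeZero K] (hK : 2 ≤ K) {t s : ℝ} (ht : 0 < t) (hs : |s| = 1)
    {v : Fin K → ℝ} (hv : ∀ k, v k = t * (s * armCoeff k)) :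
    s * armCoeff (argmax v) = 1 ∧ ∀ k, k ≠ argmax v → s * armCoeff k ≤ 1 / 2 := by
  obtain ⟨a, ha, hother⟩ := exists_mul_armCoeff_eq_one hK hs
  rw [argmax_eq_of_forall_lt (a := a) fun k hk => ?_]
  · exact ⟨ha, hother⟩
  · rw [hv, hv, ha]
    nlinarith [hother k hk]

/-- The arms with common direction `v` and scale `xbar`. -/
def arms (xbar : ℝ) (v : Fin d → ℝ) (k : Fin K) : Fin d → ℝ := (xbar * armCoeff k) • v

@[fun_prop]
theorem measurable_arms (xbar : ℝ) : Measurable (arms (K := K) (d := d) xbar) := by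
  unfold arms
  fun_prop

/-- The law of the arms whose common direction is a random sign vector. -/
def armLaw (K d : ℕ) (xbar : ℝ) : Measure (Fin K → Fin d → ℝ) := (signLaw d).map (arms xbar)

theorem measurePreserving_arms (xbar : ℝ) :
    MeasurePreserving (arms xbar) (signLaw d) (armLaw K d xbar) :=
  (measurable_arms xbar).measurePreserving _

instance (xbar : ℝ) : IsProbabilityMeasure (armLaw K d xbar) :=
  Measure.isProbabilityMeasure_map (measurable_arms xbar).aemeasurable

theorem isSubGaussian_armLaw {xbar : ℝ} (hx : 0 < xbar) (k : Fin K) :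
    IsSubGaussian (armLaw K d xbar) (fun x => x k) (2 * xbar) := by
  intro u hu
  rw [← (measurePreserving_arms xbar).lintegral_comp
    (f := fun x => ENNReal.ofReal (Real.exp ((x k ⬝ᵥ u) ^ 2 / (2 * xbar) ^ 2))) (by fun_prop),
    mul_comm 2 xbar]
  refine (isSubGaussian_signLaw d).const_smul hx ?_ u hu
  rw [abs_mul, abs_of_pos hx]
  exact mul_le_of_le_one_right hx.le (abs_armCoeff_le k)

theorem secondMoment_armLaw (xbar : ℝ) (k : Fin K) :
    secondMoment (armLaw K d xbar) (fun x => x k) = (xbar * armCoeff k) ^ 2 • 1 := by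
  rw [← secondMoment_signLaw]
  ext i j
  simp only [secondMoment, Matrix.of_apply, Matrix.smul_apply, smul_eq_mul]
  rw [← (measurePreserving_arms xbar).map_eq, integral_map (measurable_arms xbar).aemeasurable
    (by fun_prop), ← integral_const_mul]
  congr with v
  simp only [arms, Pi.smul_apply, smul_eq_mul, id]
  ring

theorem eigenvaluesWithin_smul_one {M a : ℝ} (h₁ : 1 / M < a) (h₂ : a < M) :
    EigenvaluesWithin M (a • 1 : Matrix (Fin d) (Fin d) ℝ) := by
  refine eigenvaluesWithin_of_forall_dotProduct_mulVec fun w hw => ?_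
  have hquad : w ⬝ᵥ (a • (1 : Matrix (Fin d) (Fin d) ℝ)).mulVec w = a * ∑ i, w i ^ 2 := by
    rw [Matrix.smul_mulVec, Matrix.one_mulVec, dotProduct_smul, smul_eq_mul, dotProduct]
    simp only [sq]
  have hpos := sum_sq_pos hw
  rw [hquad]
  exact ⟨by gcongr, by gcongr⟩

theorem eigenvaluesWithin_armLaw {M xbar : ℝ} (hx : 0 < xbar) (h₁ : xbar ^ 2 < M)
    (h₂ : 4 / xbar ^ 2 < M) (k : Fin K) :
    EigenvaluesWithin M (secondMoment (armLaw K d xbar) fun x => x k) := by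
  obtain ⟨hlower, hupper⟩ := armCoeff_sq_mem_Icc k
  have hx2 : 0 < xbar ^ 2 := by positivity
  rw [secondMoment_armLaw, mul_pow]
  refine eigenvaluesWithin_smul_one ?_ (lt_of_le_of_lt (mul_le_of_le_one_right hx2.le hupper) h₁)
  rw [div_lt_iff₀ hx2] at h₂
  rw [div_lt_iff₀ (hx2.trans h₁)]
  nlinarith

theorem ae_armLaw_abs_le {xbar : ℝ} (hx : 0 < xbar) :
    ∀ᵐ x ∂armLaw K d xbar, ∀ k j, |x k j| ≤ xbar := by
  refine ae_all_iff.2 fun k => ae_all_iff.2 fun j => ?_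
  rw [armLaw, ae_map_iff (measurable_arms xbar).aemeasurable
    (measurableSet_le (by fun_prop) measurable_const)]
  filter_upwards [ae_signLaw_abs] with v hv
  rw [arms, Pi.smul_apply, smul_eq_mul, abs_mul, abs_mul, hv j, abs_of_pos hx, mul_one]
  exact mul_le_of_le_one_right hx.le (abs_armCoeff_le k)

end Arms

section ArmSign

variable {K d : ℕ} [NeZero K] [NeZero d] {xbar : ℝ}

/-- The sign of the first coordinate of the first arm. It is the only part of the arms that
matters for the rewards of `signInstance`. -/
def armSign (x : Fin K → Fin d → ℝ) : ℝ := if 0 ≤ x 0 0 then 1 else -1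

@[simp]
theorem abs_armSign (x : Fin K → Fin d → ℝ) : |armSign x| = 1 := by
  unfold armSign
  split_ifs <;> simp

@[fun_prop]
theorem measurable_armSign : Measurable (armSign (K := K) (d := d)) :=
  Measurable.ite (measurableSet_le measurable_const (by fun_prop)) measurable_const
    measurable_const

theorem armSign_arms (hx : 0 < xbar) {v : Fin d → ℝ} (hv : |v 0| = 1) :
    armSign (arms (K := K) xbar v) = v 0 := by
  rcases eq_or_eq_neg_of_abs_eq hv with h | h <;> simp [armSign, arms, armCoeff, h, hx, hx.le]

theorem ae_armLaw_apply_zero (hx : 0 < xbar) :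
    ∀ᵐ x ∂armLaw K d xbar, ∀ k, x k 0 = xbar * armCoeff k * armSign x := by
  refine ae_all_iff.2 fun k => ?_
  rw [armLaw, ae_map_iff (measurable_arms xbar).aemeasurable
    (measurableSet_eq_fun (by fun_prop) (by fun_prop))]
  filter_upwards [ae_signLaw_abs] with v hv
  rw [armSign_arms hx (hv 0), arms, Pi.smul_apply, smul_eq_mul]

end ArmSign

/-! ### The hard instances -/

theorem isSparse_single {d s : ℕ} (hs : 1 ≤ s) (i : Fin d) (y : ℝ) : IsSparse s (Pi.single i y) :=
  (Finset.card_le_card (t := {i}) fun j hj => Finset.mem_singleton.2 <| by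
    by_contra hne
    exact (Finset.mem_filter.1 hj).2 (Pi.single_eq_of_ne hne _)).trans hs

section SignInstance

variable {K d : ℕ} [NeZero d] {xbar Lbar : ℝ} {θ : Fin d → ℝ} {ν : Measure (Fin d → ℝ)}
  [IsProbabilityMeasure ν]

/-- The instance with opposite rewards `± Lbar` along the first coordinate and arms that are
independent of the customer feature, which has law `ν`. -/
def signInstance (K : ℕ) (xbar Lbar : ℝ) (θ : Fin d → ℝ) (ν : Measure (Fin d → ℝ))
    [IsProbabilityMeasure ν] : Instance K d where
  θ := θ
  β g := Pi.single 0 (groupSign g * Lbar)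
  ctxLaw := (armLaw K d xbar).prod ν
  isProb := inferInstance

theorem measurePreserving_fst_signInstance : MeasurePreserving Prod.fst
    (signInstance K xbar Lbar θ ν).ctxLaw (armLaw K d xbar) :=
  measurePreserving_fst

theorem measurePreserving_snd_signInstance : MeasurePreserving Prod.snd
    (signInstance K xbar Lbar θ ν).ctxLaw ν :=
  measurePreserving_snd

@[simp]
theorem zLaw_signInstance : (signInstance K xbar Lbar θ ν).zLaw = ν :=
  measurePreserving_snd_signInstance.map_eq

theorem klDiv_ctxLaw_signInstance (θ' : Fin d → ℝ) (ν' : Measure (Fin d → ℝ))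
    [IsProbabilityMeasure ν'] :
    klDiv (signInstance K xbar Lbar θ ν).ctxLaw (signInstance K xbar Lbar θ' ν').ctxLaw =
      klDiv ν ν' :=
  klDiv_prod.trans (by rw [klDiv_self, zero_add])

theorem isSubGaussian_signInstance {κz κ : ℝ} (hx : 0 < xbar) (hκz : 0 < κz)
    (hκ : 2 * xbar + κz ≤ κ) (hsub : IsSubGaussian ν id κz) (k : Fin K) :
    IsSubGaussian (signInstance K xbar Lbar θ ν).ctxLaw (fun c => Sum.elim (c.1 k) c.2) κ :=
  ((isSubGaussian_armLaw hx k).comp_measurePreserving (by fun_prop)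
    measurePreserving_fst_signInstance).sumElim
    (hsub.comp_measurePreserving measurable_id measurePreserving_snd_signInstance)
    (by fun_prop) (by positivity) hκz hκ

theorem eigenvaluesWithin_signInstance {M : ℝ} (hx : 0 < xbar) (h₁ : xbar ^ 2 < M)
    (h₂ : 4 / xbar ^ 2 < M) (k : Fin K) :
    EigenvaluesWithin M (secondMoment (signInstance K xbar Lbar θ ν).ctxLaw fun c => c.1 k) := by
  convert eigenvaluesWithin_armLaw (d := d) hx h₁ h₂ k using 1
  ext i j
  simp only [secondMoment, Matrix.of_apply]
  rw [← (measurePreserving_fst_signInstance (θ := θ) (ν := ν) (Lbar := Lbar)).map_eq]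
  exact (integral_map (f := fun x : Fin K → Fin d → ℝ => x k i * x k j)
    measurable_fst.aemeasurable (by fun_prop)).symm

theorem beta_signInstance_ne (hL : 0 < Lbar) :
    (signInstance K xbar Lbar θ ν).β 0 ≠ (signInstance K xbar Lbar θ ν).β 1 := fun h => by
  have := congrFun h 0
  simp only [signInstance, groupSign, Pi.single_eq_same, Matrix.cons_val_zero,
    Matrix.cons_val_one] at this
  linarith

theorem sum_abs_beta_signInstance (hL : 0 < Lbar) (g : Fin 2) :
    ∑ j, |(signInstance K xbar Lbar θ ν).β g j| = Lbar := by
  rw [Finset.sum_eq_single 0 (fun j _ hj => by simp [signInstance, hj]) (by simp)]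
  simp [signInstance, abs_mul, abs_of_pos hL]

variable [NeZero K]

theorem ae_meanReward_signInstance (hx : 0 < xbar) :
    ∀ᵐ c ∂(signInstance K xbar Lbar θ ν).ctxLaw, ∀ g k,
      (signInstance K xbar Lbar θ ν).meanReward c.1 g k =
        xbar * Lbar * (groupSign g * armSign c.1 * armCoeff k) := by
  filter_upwards [measurePreserving_fst_signInstance.quasiMeasurePreserving.ae
    (ae_armLaw_apply_zero hx)] with c hc g k
  simp only [Instance.meanReward, signInstance, dotProduct_single, hc k]
  ring

theorem margin_signInstance (hK : 2 ≤ K) (hx : 0 < xbar) (hL : 0 < Lbar) {h : ℝ}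
    (hh : h ≤ xbar * Lbar / 4) (g : Fin 2) :
    (signInstance K xbar Lbar θ ν).ctxLaw.real {c | ∃ k,
      k ≠ argmax ((signInstance K xbar Lbar θ ν).meanReward c.1 g) ∧
      (signInstance K xbar Lbar θ ν).meanReward c.1 g
        (argmax ((signInstance K xbar Lbar θ ν).meanReward c.1 g)) ≤
      (signInstance K xbar Lbar θ ν).meanReward c.1 g k + h} = 0 := by
  rw [measureReal_def, measure_eq_zero_iff_ae_notMem.2, ENNReal.toReal_zero]
  filter_upwards [ae_meanReward_signInstance hx] with c hc
  rintro ⟨k, hk, hle⟩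
  have hscale : 0 < xbar * Lbar := mul_pos hx hL
  obtain ⟨hbest, hother⟩ := argmax_mul_armCoeff hK hscale
    (by simp [abs_mul] : |groupSign g * armSign c.1| = 1) (hc g)
  rw [hc g, hc g, hbest] at hle
  nlinarith [hother k hk]

theorem inClass_signInstance {s : ℕ} {ξ M κz κ C hbar : ℝ} (hK : 2 ≤ K) (hs : 1 ≤ s)
    (hx : 0 < xbar) (hL : 0 < Lbar) (hM₁ : xbar ^ 2 < M) (hM₂ : 4 / xbar ^ 2 < M)
    (hκz : 0 < κz) (hκ : 2 * xbar + κz ≤ κ) (hC : 0 < C) (hh : hbar ≤ xbar * Lbar / 4)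
    (hθ : IsSparse s θ) (hnd : NondegenerateGroups ξ θ ν) (hsub : IsSubGaussian ν id κz)
    (heig : EigenvaluesWithin M (secondMoment ν id)) :
    InClass s xbar Lbar ξ M κ C hbar (signInstance K xbar Lbar θ ν) where
  sparse_theta := hθ
  sparse_beta _ := isSparse_single hs _ _
  beta_ne := beta_signInstance_ne hL
  nondegenerate := by rwa [zLaw_signInstance]
  subGaussian := isSubGaussian_signInstance hx hκz hκ hsub
  eigenvalues_x := eigenvaluesWithin_signInstance hx hM₁ hM₂
  eigenvalues_z := by rwa [zLaw_signInstance]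
  bounded_x := measurePreserving_fst_signInstance.quasiMeasurePreserving.ae (ae_armLaw_abs_le hx)
  bounded_beta g := (sum_abs_beta_signInstance hL g).le
  margin g h hmem := by
    rw [margin_signInstance hK hx hL (hmem.2.trans hh) g]
    exact mul_nonneg hC.le hmem.1

end SignInstance

/-! ### The law of one round -/

theorem integrable_of_abs_le {Ω : Type*} [MeasurableSpace Ω] {P : Measure Ω} [IsFiniteMeasure P]
    {f : Ω → ℝ} (hf : Measurable f) {b : ℝ} (hb : ∀ ω, |f ω| ≤ b) : Integrable f P :=
  Integrable.of_bound hf.aestronglyMeasurable b (ae_of_all _ hb)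

theorem abs_integral_le_of_abs_le {Ω : Type*} [MeasurableSpace Ω] {P : Measure Ω}
    [IsProbabilityMeasure P] {f : Ω → ℝ} {b : ℝ} (hb : ∀ ω, |f ω| ≤ b) : |∫ ω, f ω ∂P| ≤ b := by
  simpa using norm_integral_le_of_norm_le_const (μ := P) (f := f) (ae_of_all _ hb)

section Round

variable {K d : ℕ} (μ : Instance K d) (σ : ℝ≥0) (π : Policy K d) (n : ℕ)

instance : IsProbabilityMeasure μ.zLaw :=
  Measure.isProbabilityMeasure_map measurable_snd.aemeasurable

instance : IsProbabilityMeasure (roundLaw μ σ π n) :=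
  Measure.isProbabilityMeasure_map measurable_snd.aemeasurable

theorem measurePreserving_fst_roundLaw :
    MeasurePreserving Prod.fst (roundLaw μ σ π n) (μ.latentLaw σ) := by
  refine ⟨measurable_fst, ?_⟩
  have hcomp : roundLaw μ σ π n = roundKernel μ σ π n ∘ₘ histLaw μ σ π n :=
    Measure.snd_compProd _ _
  rw [hcomp, Measure.map_comp _ _ measurable_fst, ← Kernel.fst_eq, roundKernel,
    Kernel.fst_compProd, Measure.const_comp, measure_univ, one_smul]

theorem measurePreserving_context_roundLaw :
    MeasurePreserving (fun w => w.1.1) (roundLaw μ σ π n) μ.ctxLaw :=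
  (⟨measurable_fst, Measure.fst_compProd _ _⟩ : MeasurePreserving Prod.fst (μ.latentLaw σ)
    μ.ctxLaw).comp (measurePreserving_fst_roundLaw μ σ π n)

theorem measurePreserving_label_roundLaw :
    MeasurePreserving (fun w => (w.1.1.2, w.1.2.1)) (roundLaw μ σ π n)
      (μ.zLaw ⊗ₘ groupKernel μ.θ) := by
  have hlatent : MeasurePreserving (fun w : Ctx K d × Fin 2 × ℝ => (w.1.2, w.2.1))
      (μ.latentLaw σ) (μ.zLaw ⊗ₘ groupKernel μ.θ) := by
    refine ⟨by fun_prop, Measure.ext_of_lintegral _ fun f hf => ?_⟩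
    rw [lintegral_map hf (by fun_prop), lintegral_latentLaw _ _ (by fun_prop),
      Measure.lintegral_compProd hf, Instance.zLaw,
      lintegral_map (by fun_prop) measurable_snd]
    simp
  exact hlatent.comp (measurePreserving_fst_roundLaw μ σ π n)

theorem integral_roundLaw {f : Ctx K d → Fin 2 → Fin K → ℝ}
    (hf : Measurable fun q : Ctx K d × Fin 2 × Fin K => f q.1 q.2.1 q.2.2) {b : ℝ}
    (hb : ∀ c g a, |f c g a| ≤ b) :
    ∫ w, f w.1.1 w.1.2.1 w.2 ∂roundLaw μ σ π n =
      ∫ h, ∫ c, ∫ g, ∫ a, f c g a ∂π.act n (h, c) ∂groupKernel μ.θ c.2 ∂μ.ctxLaw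
        ∂histLaw μ σ π n := by
  have hm : Measurable fun w : (Ctx K d × Fin 2 × ℝ) × Fin K => f w.1.1 w.1.2.1 w.2 :=
    hf.comp (f := fun w : (Ctx K d × Fin 2 × ℝ) × Fin K => (w.1.1, w.1.2.1, w.2)) (by fun_prop)
  have hm' : Measurable fun q : Hist K d n × (Ctx K d × Fin 2 × ℝ) × Fin K =>
      f q.2.1.1 q.2.1.2.1 q.2.2 := hm.comp measurable_snd
  rw [roundLaw, integral_map measurable_snd.aemeasurable hm.aestronglyMeasurable,
    Measure.integral_compProd (integrable_of_abs_le hm' fun q => hb _ _ _)]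
  congr with h
  have hact : Measurable fun w : Ctx K d × Fin 2 × ℝ =>
      ∫ a, f w.1 w.2.1 a ∂π.act n (h, w.1) :=
    (hm.stronglyMeasurable.integral_kernel_prod_right' (κ := (π.act n).comap
      (fun w : Ctx K d × Fin 2 × ℝ => (h, w.1)) (by fun_prop))).measurable
  rw [roundKernel, integral_compProd (integrable_of_abs_le hm fun w => hb _ _ _)]
  simp only [Kernel.const_apply, Kernel.comap_apply]
  rw [Instance.latentLaw, Measure.integral_compProd (integrable_of_abs_le hact fun w =>
    abs_integral_le_of_abs_le fun a => hb _ _ _)]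
  congr with c
  rw [Kernel.prod_apply, Kernel.comap_apply, Kernel.const_apply,
    integral_fun_fst (f := fun g => ∫ a, f c g a ∂π.act n (h, c)), probReal_univ, one_smul]

end Round

/-! ### The response of a policy -/

section Response

variable {K d : ℕ}

/-- The mean coefficient of the arm chosen by a policy, given the history and the features. -/
def meanCoeff (π : Policy K d) (n : ℕ) (q : Hist K d n × Ctx K d) : ℝ :=
  ∫ a, armCoeff a ∂π.act n q

@[fun_prop]
theorem measurable_meanCoeff (π : Policy K d) (n : ℕ) : Measurable (meanCoeff π n) :=
  StronglyMeasurable.integral_kernel (by fun_prop) |>.measurable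

theorem abs_meanCoeff_le (π : Policy K d) (n : ℕ) (q : Hist K d n × Ctx K d) :
    |meanCoeff π n q| ≤ 1 :=
  abs_integral_le_of_abs_le abs_armCoeff_le

variable [NeZero K] [NeZero d]

/-- The mean signed coefficient of the arm chosen by a policy, given the history and the customer
feature only. A good policy responds with the sign of the group that the feature suggests. -/
def response (π : Policy K d) (xbar : ℝ) (n : ℕ) (h : Hist K d n) (z : Fin d → ℝ) : ℝ :=
  ∫ x, armSign x * meanCoeff π n (h, (x, z)) ∂armLaw K d xbar

theorem abs_armSign_mul_le (x : Fin K → Fin d → ℝ) {y : ℝ} (hy : |y| ≤ 1) :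
    |armSign x * y| ≤ 1 := by
  rwa [abs_mul, abs_armSign, one_mul]

theorem abs_response_le (π : Policy K d) (xbar : ℝ) (n : ℕ) (h : Hist K d n) (z : Fin d → ℝ) :
    |response π xbar n h z| ≤ 1 :=
  abs_integral_le_of_abs_le fun x => abs_armSign_mul_le x (abs_meanCoeff_le π n _)

theorem measurable_response (π : Policy K d) (xbar : ℝ) (n : ℕ) :
    Measurable fun q : Hist K d n × (Fin d → ℝ) => response π xbar n q.1 q.2 := by
  have hm : Measurable fun q : (Hist K d n × (Fin d → ℝ)) × (Fin K → Fin d → ℝ) =>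
      armSign q.2 * meanCoeff π n (q.1.1, (q.2, q.1.2)) := by
    fun_prop
  exact (hm.stronglyMeasurable.integral_prod_right' (ν := armLaw K d xbar)).measurable

@[fun_prop]
theorem measurable_response_right (π : Policy K d) (xbar : ℝ) (n : ℕ) (h : Hist K d n) :
    Measurable (response π xbar n h) :=
  (measurable_response π xbar n).comp measurable_prodMk_left

end Response

/-! ### Regrets of the hard instances -/

section SignInstanceRegret

variable {K d : ℕ} [NeZero K] [NeZero d] {xbar Lbar : ℝ} {θ : Fin d → ℝ}
  {ν : Measure (Fin d → ℝ)} [IsProbabilityMeasure ν]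

theorem ae_instantRegular_eq (hK : 2 ≤ K) (hx : 0 < xbar) (hL : 0 < Lbar) (σ : ℝ≥0)
    (π : Policy K d) (n : ℕ) : ∀ᵐ w ∂roundLaw (signInstance K xbar Lbar θ ν) σ π n,
      instantRegular (signInstance K xbar Lbar θ ν) w =
        xbar * Lbar *
          (groupSign w.1.2.1 *
            (groupSign (classify θ w.1.1.2) - armSign w.1.1.1 * armCoeff w.2)) := by
  filter_upwards [(measurePreserving_context_roundLaw _ σ π n).quasiMeasurePreserving.ae
    (ae_meanReward_signInstance hx)] with w hw
  set g := classify θ w.1.1.2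
  have hbest : groupSign g * armSign w.1.1.1 *
      armCoeff (regularArm (signInstance K xbar Lbar θ ν) w.1.1) = 1 :=
    (argmax_mul_armCoeff hK (mul_pos hx hL) (by simp [abs_mul]) (hw g)).1
  have hregular : armSign w.1.1.1 * armCoeff (regularArm (signInstance K xbar Lbar θ ν) w.1.1) =
      groupSign g := by
    linear_combination groupSign g * hbest -
      armSign w.1.1.1 * armCoeff (regularArm (signInstance K xbar Lbar θ ν) w.1.1) *
        groupSign_mul_self g
  rw [instantRegular, hw, hw, ← hregular]
  ring

theorem ae_instantStrong_eq (hK : 2 ≤ K) (hx : 0 < xbar) (hL : 0 < Lbar) (σ : ℝ≥0)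
    (π : Policy K d) (n : ℕ) : ∀ᵐ w ∂roundLaw (signInstance K xbar Lbar θ ν) σ π n,
      instantStrong (signInstance K xbar Lbar θ ν) w =
        instantRegular (signInstance K xbar Lbar θ ν) w + 2 * (xbar * Lbar) *
          {w | classify θ w.1.1.2 ≠ w.1.2.1}.indicator 1 w := by
  filter_upwards [(measurePreserving_context_roundLaw _ σ π n).quasiMeasurePreserving.ae
    (ae_meanReward_signInstance hx), ae_instantRegular_eq hK hx hL σ π n] with w hw hregular
  have hbest := (argmax_mul_armCoeff hK (mul_pos hx hL) (by simp [abs_mul]) (hw w.1.2.1)).1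
  have hlabels (g g' : Fin 2) :
      1 - groupSign g' * groupSign g = 2 * (if g ≠ g' then 1 else 0 : ℝ) := by
    fin_cases g <;> fin_cases g' <;> norm_num [groupSign]
  rw [instantStrong, iSup_eq_argmax, hw, hw, hbest, hregular, Set.indicator_apply]
  simp only [Set.mem_ofPred_eq, Pi.one_apply]
  linear_combination xbar * Lbar * hlabels (classify θ w.1.1.2) w.1.2.1

theorem abs_groupSign_mul_sub_le (g g' : Fin 2) {y : ℝ} (hy : |y| ≤ 1) :
    |groupSign g * (groupSign g' - y)| ≤ 2 := by
  rw [abs_mul, abs_groupSign, one_mul]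
  linarith [abs_sub (groupSign g') y, abs_groupSign g']

theorem integrable_instantRegular (hK : 2 ≤ K) (hx : 0 < xbar) (hL : 0 < Lbar) (σ : ℝ≥0)
    (π : Policy K d) (n : ℕ) : Integrable (instantRegular (signInstance K xbar Lbar θ ν))
      (roundLaw (signInstance K xbar Lbar θ ν) σ π n) := by
  refine (Integrable.const_mul (integrable_of_abs_le (b := 2) (by fun_prop) fun w => ?_) _).congr
    (Filter.EventuallyEq.symm (ae_instantRegular_eq hK hx hL σ π n))
  exact abs_groupSign_mul_sub_le _ _ (abs_armSign_mul_le _ (abs_armCoeff_le _))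

/- Given the history and the features, the label has mean `groupBias ⟨z, θ⟩`, so that only the
mean response of the policy to `z` matters. -/
theorem integral_instantRegular (hK : 2 ≤ K) (hx : 0 < xbar) (hL : 0 < Lbar) (σ : ℝ≥0)
    (π : Policy K d) (n : ℕ) :
    ∫ w, instantRegular (signInstance K xbar Lbar θ ν) w
        ∂roundLaw (signInstance K xbar Lbar θ ν) σ π n =
      xbar * Lbar * ∫ h, ∫ z, (|groupBias (z ⬝ᵥ θ)| - groupBias (z ⬝ᵥ θ) * response π xbar n h z)
        ∂ν ∂histLaw (signInstance K xbar Lbar θ ν) σ π n := by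
  rw [integral_congr_ae (ae_instantRegular_eq hK hx hL σ π n), integral_const_mul,
    integral_roundLaw _ σ π n (f := fun c g a =>
      groupSign g * (groupSign (classify θ c.2) - armSign c.1 * armCoeff a)) (by fun_prop)
      fun c g a => abs_groupSign_mul_sub_le _ _ (abs_armSign_mul_le _ (abs_armCoeff_le a))]
  congr with h
  have hround (c : Ctx K d) : ∫ g, ∫ a, groupSign g *
      (groupSign (classify θ c.2) - armSign c.1 * armCoeff a) ∂π.act n (h, c) ∂groupKernel θ c.2 =
      groupBias (c.2 ⬝ᵥ θ) * (groupSign (classify θ c.2) -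
        armSign c.1 * meanCoeff π n (h, c)) := by
    simp only [integral_const_mul]
    rw [integral_mul_const, integral_groupSign, integral_sub (integrable_const _)
      (Integrable.of_finite), integral_const, probReal_univ, one_smul, integral_const_mul,
      meanCoeff]
  have hbound (c : Ctx K d) : |armSign c.1 * meanCoeff π n (h, c)| ≤ 1 :=
    abs_armSign_mul_le _ (abs_meanCoeff_le π n _)
  change ∫ c, ∫ g, ∫ a, groupSign g * (groupSign (classify θ c.2) - armSign c.1 * armCoeff a)
    ∂π.act n (h, c) ∂groupKernel θ c.2 ∂(armLaw K d xbar).prod ν = _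
  simp only [hround]
  rw [integral_prod_symm _ (integrable_of_abs_le (b := 2) (by fun_prop) fun c => ?_)]
  · congr with z
    dsimp only
    rw [integral_const_mul, integral_sub (integrable_const _)
      (integrable_of_abs_le (by fun_prop) fun x => hbound (x, z)), integral_const, probReal_univ,
      one_smul, ← response, ← groupSign_classify_mul_groupBias]
    ring
  · rw [abs_mul]
    refine (mul_le_of_le_one_left (abs_nonneg _) (abs_groupBias_le_one _)).trans ?_
    linarith [abs_sub (groupSign (classify θ c.2)) (armSign c.1 * meanCoeff π n (h, c)),
      abs_groupSign (classify θ c.2), hbound c]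

theorem groupBias_mul_response_le (π : Policy K d) (n : ℕ) (h : Hist K d n) (z : Fin d → ℝ) :
    groupBias (z ⬝ᵥ θ) * response π xbar n h z ≤ |groupBias (z ⬝ᵥ θ)| :=
  (le_abs_self _).trans <| (abs_mul _ _).trans_le <|
    mul_le_of_le_one_right (abs_nonneg _) (abs_response_le _ _ _ _ _)

theorem integral_instantRegular_nonneg (hK : 2 ≤ K) (hx : 0 < xbar) (hL : 0 < Lbar) (σ : ℝ≥0)
    (π : Policy K d) (n : ℕ) :
    0 ≤ ∫ w, instantRegular (signInstance K xbar Lbar θ ν) w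
      ∂roundLaw (signInstance K xbar Lbar θ ν) σ π n := by
  rw [integral_instantRegular hK hx hL]
  exact mul_nonneg (mul_pos hx hL).le (integral_nonneg fun h => integral_nonneg fun z =>
    sub_nonneg.2 (groupBias_mul_response_le π n h z))

theorem integral_instantStrong_ge (hK : 2 ≤ K) (hx : 0 < xbar) (hL : 0 < Lbar) (σ : ℝ≥0)
    (π : Policy K d) (n : ℕ) :
    2 * (xbar * Lbar) * misclassError θ ν ≤ ∫ w, instantStrong (signInstance K xbar Lbar θ ν) w
      ∂roundLaw (signInstance K xbar Lbar θ ν) σ π n := by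
  set μ := signInstance K xbar Lbar θ ν
  have hlabel : MeasurePreserving (fun w => (w.1.1.2, w.1.2.1)) (roundLaw μ σ π n)
      (ν ⊗ₘ groupKernel θ) :=
    zLaw_signInstance (K := K) (ν := ν) ▸ measurePreserving_label_roundLaw μ σ π n
  have herror : MeasurableSet {q : (Fin d → ℝ) × Fin 2 | classify θ q.1 ≠ q.2} :=
    (measurableSet_eq_fun (by fun_prop) measurable_snd).compl
  have herror' : MeasurableSet {w : (Ctx K d × Fin 2 × ℝ) × Fin K | classify θ w.1.1.2 ≠ w.1.2.1} :=
    hlabel.measurable herror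
  have hprob : (roundLaw μ σ π n).real {w | classify θ w.1.1.2 ≠ w.1.2.1} = misclassError θ ν := by
    rw [misclassError, measureReal_def, measureReal_def,
      ← hlabel.measure_preimage herror.nullMeasurableSet]
    rfl
  have hregular := integral_instantRegular_nonneg (θ := θ) (ν := ν) hK hx hL σ π n
  have hind : Integrable ({w | classify θ w.1.1.2 ≠ w.1.2.1}.indicator 1 : _ → ℝ)
      (roundLaw μ σ π n) := (integrable_const (1 : ℝ)).indicator herror'
  rw [integral_congr_ae (ae_instantStrong_eq hK hx hL σ π n),
    integral_add (integrable_instantRegular hK hx hL σ π n) (hind.const_mul _),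
    integral_const_mul, integral_indicator_one herror', hprob]
  linarith

end SignInstanceRegret

/-! ### Spikes with random positions and signs -/

theorem sum_integral_le_of_klDiv_le {ι α : Type*} [Fintype ι] [MeasurableSpace α]
    {P : ι → Measure α} {Q : Measure α} [∀ i, IsProbabilityMeasure (P i)] [IsProbabilityMeasure Q]
    {k : ℝ} (hk : 0 ≤ k) (hPQ : ∀ i, klDiv (P i) Q ≤ ENNReal.ofReal k) {F : ι → α → ℝ}
    (hF : ∀ i, Measurable (F i)) {b : ℝ} (hb : ∀ i a, |F i a| ≤ b) {c : ℝ}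
    (hexp : ∀ a, ∑ i, Real.exp (F i a) ≤ Fintype.card ι * Real.exp c) :
    ∑ i, ∫ a, F i a ∂P i ≤ Fintype.card ι * (k + c) := by
  have hint (i : ι) : Integrable (fun a => Real.exp (F i a)) Q :=
    integrable_of_abs_le (hF i).exp fun a => by
      rw [Real.abs_exp]
      exact Real.exp_le_exp.2 ((le_abs_self _).trans (hb i a))
  have hterm (i : ι) :
      ∫ a, F i a ∂P i ≤ k + c - 1 + (∫ a, Real.exp (F i a) ∂Q) / Real.exp c := by
    have hkl : (klDiv (P i) Q).toReal ≤ k := ENNReal.toReal_le_of_le_ofReal hk (hPQ i)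
    have hlog := Real.log_le_sub_one_of_pos
      (div_pos (integral_exp_pos (hint i)) (Real.exp_pos c))
    rw [Real.log_div (integral_exp_pos (hint i)).ne' (Real.exp_pos c).ne', Real.log_exp] at hlog
    linarith [integral_le_toReal_klDiv_add_log ((hPQ i).trans_lt ENNReal.ofReal_lt_top).ne
      (integrable_of_abs_le (hF i) (hb i)) (hint i)]
  have hsum : ∑ i, ∫ a, Real.exp (F i a) ∂Q ≤ Fintype.card ι * Real.exp c := by
    rw [← integral_finsetSum _ fun i _ => hint i]
    exact (integral_mono (integrable_finsetSum _ fun i _ => hint i) (integrable_const _)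
      hexp).trans_eq (by simp)
  calc ∑ i, ∫ a, F i a ∂P i
      ≤ ∑ i, (k + c - 1 + (∫ a, Real.exp (F i a) ∂Q) / Real.exp c) :=
        Finset.sum_le_sum fun i _ => hterm i
    _ = Fintype.card ι * (k + c - 1) + (∑ i, ∫ a, Real.exp (F i a) ∂Q) / Real.exp c := by
        rw [Finset.sum_add_distrib, Finset.sum_div, Finset.sum_const, Finset.card_univ,
          nsmul_eq_mul]
    _ ≤ Fintype.card ι * (k + c - 1) + Fintype.card ι := by
        gcongr
        exact (div_le_iff₀ (Real.exp_pos c)).2 hsum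
    _ = Fintype.card ι * (k + c) := by ring

theorem cosh_sub_one_le {x t : ℝ} (hx : |x| ≤ t) : Real.cosh x - 1 ≤ x ^ 2 * Real.exp t / 2 := by
  wlog h0 : 0 ≤ x generalizing x
  · simpa using this (x := -x) (by rwa [abs_neg]) (by linarith)
  have hinv : Real.exp x * Real.exp (-x) = 1 := by
    rw [← Real.exp_add, add_neg_cancel, Real.exp_zero]
  have hcosh : Real.cosh x - 1 = (Real.exp x - 1) ^ 2 * Real.exp (-x) / 2 := by
    rw [Real.cosh_eq]
    linear_combination (-(Real.exp x) / 2 + 1) * hinv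
  have hexp : Real.exp x - 1 ≤ x * Real.exp x := by
    nlinarith [Real.add_one_le_exp (-x), Real.exp_pos x]
  calc Real.cosh x - 1 = (Real.exp x - 1) ^ 2 * Real.exp (-x) / 2 := hcosh
    _ ≤ (x * Real.exp x) ^ 2 * Real.exp (-x) / 2 := by
        gcongr
        linarith [Real.add_one_le_exp x]
    _ = x ^ 2 * Real.exp x / 2 := by linear_combination x ^ 2 * Real.exp x / 2 * hinv
    _ ≤ x ^ 2 * Real.exp t / 2 := by
        gcongr
        exact (le_abs_self x).trans hx

theorem abs_sum_groupSign_mul_le {ι : Type*} [Fintype ι] {y : ι → ℝ} {t : ℝ}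
    (hy : ∀ i, |y i| ≤ t) (g : ι → Fin 2) :
    |∑ i, groupSign (g i) * y i| ≤ Fintype.card ι * t := by
  refine (Finset.abs_sum_le_sum_abs _ _).trans ?_
  simp only [abs_mul, abs_groupSign, one_mul]
  exact (Finset.sum_le_card_nsmul _ _ t fun i _ => hy i).trans_eq
    (by rw [Finset.card_univ, nsmul_eq_mul])

theorem abs_sub_truncation_le {α : Type*} (f : α → ℝ) {ρ : ℝ} (hρ : 0 < ρ) (a : α) :
    |f a - truncation f ρ a| ≤ f a ^ 2 / ρ := by
  by_cases ha : f a ∈ Set.Ioc (-ρ) ρ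
  · rw [truncation, Function.comp_apply, Set.indicator_of_mem ha, id, sub_self, abs_zero]
    positivity
  · rw [truncation, Function.comp_apply, Set.indicator_of_notMem ha, sub_zero, le_div_iff₀ hρ,
      ← sq_abs, sq]
    refine mul_le_mul_of_nonneg_left (le_of_not_gt fun hlt => ha ?_) (abs_nonneg _)
    exact ⟨(abs_lt.1 hlt).1, (abs_lt.1 hlt).2.le⟩

section RandomSpikes

variable {ι κ : Type*} [Fintype ι] [Fintype κ]

theorem sum_exp_groupSign_mul_le [Nonempty κ] {t : ℝ} {x : κ → ℝ} (hx : ∀ j, |x j| ≤ t) :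
    ∑ p : κ × Fin 2, Real.exp (groupSign p.2 * x p.1) ≤ 2 * Fintype.card κ *
      Real.exp ((∑ j, x j ^ 2) * Real.exp t / (2 * Fintype.card κ)) := by
  calc ∑ p : κ × Fin 2, Real.exp (groupSign p.2 * x p.1) = ∑ j, 2 * Real.cosh (x j) := by
        rw [Fintype.sum_prod_type]
        refine Finset.sum_congr rfl fun j _ => ?_
        rw [Fin.sum_univ_two, Real.cosh_eq]
        simp only [groupSign, Matrix.cons_val_zero, Matrix.cons_val_one, one_mul, neg_one_mul]
        ring
    _ ≤ ∑ j, (2 + x j ^ 2 * Real.exp t) :=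
        Finset.sum_le_sum fun j _ => by linarith [cosh_sub_one_le (hx j)]
    _ = 2 * Fintype.card κ * ((∑ j, x j ^ 2) * Real.exp t / (2 * Fintype.card κ) + 1) := by
        rw [Finset.sum_add_distrib, ← Finset.sum_mul, Finset.sum_const, Finset.card_univ,
          nsmul_eq_mul]
        field_simp
        ring
    _ ≤ _ := by
        gcongr
        exact Real.add_one_le_exp _

theorem sum_exp_sum_groupSign_mul_le [DecidableEq ι] [Nonempty κ] {t v : ℝ}
    {x : ι × κ → ℝ} (hx : ∀ p, |x p| ≤ t) (hv : ∑ p, x p ^ 2 ≤ v) :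
    ∑ ω : ι → κ × Fin 2, Real.exp (∑ i, groupSign (ω i).2 * x (i, (ω i).1)) ≤
      Fintype.card (ι → κ × Fin 2) * Real.exp (v * Real.exp t / (2 * Fintype.card κ)) := by
  simp only [Real.exp_sum]
  rw [← Fintype.prod_sum (κ := fun _ : ι => κ × Fin 2)
    (f := fun i p => Real.exp (groupSign p.2 * x (i, p.1)))]
  calc ∏ i, ∑ p : κ × Fin 2, Real.exp (groupSign p.2 * x (i, p.1))
      ≤ ∏ i, (2 * Fintype.card κ *
          Real.exp ((∑ j, x (i, j) ^ 2) * Real.exp t / (2 * Fintype.card κ))) :=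
        Finset.prod_le_prod (fun i _ => Finset.sum_nonneg fun p _ => (Real.exp_pos _).le)
          fun i _ => sum_exp_groupSign_mul_le fun j => hx (i, j)
    _ = Fintype.card (ι → κ × Fin 2) *
          Real.exp ((∑ p, x p ^ 2) * Real.exp t / (2 * Fintype.card κ)) := by
        rw [Finset.prod_mul_distrib, ← Real.exp_sum, ← Finset.sum_div, ← Finset.sum_mul,
          ← Fintype.sum_prod_type (f := fun p => x p ^ 2)]
        simp [mul_comm]
    _ ≤ _ := by gcongr

theorem sum_groupSign_mul_le_add_one_div {ρ : ℝ} (hρ : 0 < ρ) {x y : ι × κ → ℝ}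
    (hxy : ∀ p, |x p - y p| ≤ x p ^ 2 / ρ) (hx1 : ∑ p, x p ^ 2 ≤ 1) (ω : ι → κ × Fin 2) :
    ∑ i, groupSign (ω i).2 * x (i, (ω i).1) ≤
      ∑ i, groupSign (ω i).2 * y (i, (ω i).1) + 1 / ρ := by
  have hsq : ∑ i, x (i, (ω i).1) ^ 2 ≤ 1 := by
    refine (Finset.sum_le_sum fun i _ => ?_).trans
      ((Fintype.sum_prod_type (f := fun p => x p ^ 2)).symm.trans_le hx1)
    exact Finset.single_le_sum (f := fun j => x (i, j) ^ 2) (fun j _ => sq_nonneg _)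
      (Finset.mem_univ _)
  calc ∑ i, groupSign (ω i).2 * x (i, (ω i).1)
      ≤ ∑ i, (groupSign (ω i).2 * y (i, (ω i).1) + x (i, (ω i).1) ^ 2 / ρ) := by
        refine Finset.sum_le_sum fun i _ => sub_le_iff_le_add'.1 ?_
        rw [← mul_sub]
        refine (le_abs_self _).trans ?_
        rw [abs_mul, abs_groupSign, one_mul]
        exact hxy _
    _ ≤ _ := by
        rw [Finset.sum_add_distrib, ← Finset.sum_div]
        gcongr

variable [DecidableEq ι] [Nonempty κ] {α : Type*} [MeasurableSpace α]
  {P : (ι → κ × Fin 2) → Measure α} {Q : Measure α} [∀ ω, IsProbabilityMeasure (P ω)]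
  [IsProbabilityMeasure Q] {k ρ : ℝ} {x : ι × κ → α → ℝ}

/- Apply Donsker–Varadhan to the statistic scaled by `t / ρ`, where `2 * card κ = exp (2 * t)`. -/
theorem sum_integral_sum_groupSign_mul_le_of_abs_le (hk : 0 ≤ k)
    (hPQ : ∀ ω, klDiv (P ω) Q ≤ ENNReal.ofReal k) (hx : ∀ p, Measurable (x p)) (hρ : 0 < ρ)
    (hxρ : ∀ p a, |x p a| ≤ ρ) (hx1 : ∀ a, ∑ p, x p a ^ 2 ≤ 1) :
    ∑ ω, ∫ a, ∑ i, groupSign (ω i).2 * x (i, (ω i).1) a ∂P ω ≤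
      Fintype.card (ι → κ × Fin 2) * (2 * ρ * k / Real.log (2 * Fintype.card κ) + 1 / ρ) := by
  have hκ : (1 : ℝ) ≤ Fintype.card κ := Nat.one_le_cast.2 Fintype.card_pos
  obtain ⟨t, ht, hlog⟩ : ∃ t : ℝ, 0 < t ∧ Real.log (2 * Fintype.card κ) = 2 * t :=
    ⟨Real.log (2 * Fintype.card κ) / 2, half_pos (Real.log_pos (by linarith)), by ring⟩
  have hcard : 2 * (Fintype.card κ : ℝ) = Real.exp t * Real.exp t := by
    rw [← Real.exp_add, ← two_mul, ← hlog, Real.exp_log (by linarith)]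
  have hscaled (p : ι × κ) (a : α) : |t / ρ * x p a| ≤ t := by
    rw [abs_mul, abs_of_pos (by positivity), div_mul_eq_mul_div, div_le_iff₀ hρ]
    exact mul_le_mul_of_nonneg_left (hxρ p a) ht.le
  have hexp (a : α) : ∑ ω : ι → κ × Fin 2,
      Real.exp (∑ i, groupSign (ω i).2 * (t / ρ * x (i, (ω i).1) a)) ≤
        Fintype.card (ι → κ × Fin 2) * Real.exp (t / ρ ^ 2) := by
    refine (sum_exp_sum_groupSign_mul_le (x := fun p => t / ρ * x p a) (v := (t / ρ) ^ 2)
      (fun p => hscaled p a) ?_).trans ?_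
    · simp only [mul_pow, ← Finset.mul_sum]
      exact mul_le_of_le_one_right (sq_nonneg _) (hx1 a)
    · refine mul_le_mul_of_nonneg_left (Real.exp_le_exp.2 ?_) (Nat.cast_nonneg _)
      rw [hcard, mul_div_mul_right _ _ (Real.exp_pos t).ne', div_pow, div_div,
        div_le_div_iff₀ (by positivity) (by positivity)]
      have : t ≤ Real.exp t := by linarith [Real.add_one_le_exp t]
      nlinarith [mul_le_mul_of_nonneg_left this (mul_pos ht (pow_pos hρ 2)).le]
  have hsum := sum_integral_le_of_klDiv_le hk hPQ (fun ω => by fun_prop)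
    (fun ω a => abs_sum_groupSign_mul_le (fun i => hscaled _ a) fun i => (ω i).2) hexp
  simp only [mul_left_comm _ (t / ρ), ← Finset.mul_sum, integral_const_mul] at hsum
  calc _ ≤ Fintype.card (ι → κ × Fin 2) * (k + t / ρ ^ 2) / (t / ρ) :=
        (le_div_iff₀' (by positivity)).2 hsum
    _ = _ := by
        rw [hlog]
        field_simp

theorem sum_integral_sum_groupSign_mul_le (hk : 0 ≤ k)
    (hPQ : ∀ ω, klDiv (P ω) Q ≤ ENNReal.ofReal k) (hx : ∀ p, Measurable (x p)) (hρ : 0 < ρ)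
    (hx1 : ∀ a, ∑ p, x p a ^ 2 ≤ 1) :
    ∑ ω, ∫ a, ∑ i, groupSign (ω i).2 * x (i, (ω i).1) a ∂P ω ≤
      Fintype.card (ι → κ × Fin 2) * (2 * ρ * k / Real.log (2 * Fintype.card κ) + 2 / ρ) := by
  set y : ι × κ → α → ℝ := fun p => truncation (x p) ρ
  have hy_meas (p : ι × κ) : Measurable (y p) :=
    (measurable_id.indicator measurableSet_Ioc).comp (hx p)
  have hyρ (p : ι × κ) (a : α) : |y p a| ≤ ρ :=
    (abs_truncation_le_bound _ _ _).trans_eq (abs_of_pos hρ)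
  have hy1 (a : α) : ∑ p, y p a ^ 2 ≤ 1 :=
    (Finset.sum_le_sum fun p _ => sq_le_sq.2 (abs_truncation_le_abs_self _ _ _)).trans (hx1 a)
  have hx_le (p : ι × κ) (a : α) : |x p a| ≤ 1 := (sq_le_one_iff_abs_le_one _).1 <|
    (Finset.single_le_sum (f := fun p => x p a ^ 2) (fun p _ => sq_nonneg _)
      (Finset.mem_univ p)).trans (hx1 a)
  have hinty (ω : ι → κ × Fin 2) :
      Integrable (fun a => ∑ i, groupSign (ω i).2 * y (i, (ω i).1) a) (P ω) :=
    integrable_of_abs_le (by fun_prop) fun a =>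
      abs_sum_groupSign_mul_le (fun i => hyρ _ a) fun i => (ω i).2
  have hround (ω : ι → κ × Fin 2) : ∫ a, ∑ i, groupSign (ω i).2 * x (i, (ω i).1) a ∂P ω ≤
      ∫ a, ∑ i, groupSign (ω i).2 * y (i, (ω i).1) a ∂P ω + 1 / ρ := by
    refine (integral_mono (integrable_of_abs_le (by fun_prop) fun a =>
      abs_sum_groupSign_mul_le (fun i => hx_le _ a) fun i => (ω i).2)
      ((hinty ω).add (integrable_const _)) fun a => sum_groupSign_mul_le_add_one_div hρ
        (fun p => abs_sub_truncation_le _ hρ a) (hx1 a) ω).trans_eq ?_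
    simp [integral_add (hinty ω) (integrable_const _)]
  refine (Finset.sum_le_sum fun ω _ => hround ω).trans ?_
  rw [Finset.sum_add_distrib, Finset.sum_const, Finset.card_univ, nsmul_eq_mul]
  have := sum_integral_sum_groupSign_mul_le_of_abs_le hk hPQ hy_meas hρ hyρ hy1
  linear_combination this

end RandomSpikes

/-- The vector with one entry `± η` in each block of positions `pos (i, ·)`; `ω` gives its
position and its sign. -/
def spikes {d s m : ℕ} (pos : Fin s × Fin m ↪ Fin d) (η : ℝ) (ω : Fin s → Fin m × Fin 2) :
    Fin d → ℝ :=
  ∑ i, Pi.single (pos (i, (ω i).1)) (η * groupSign (ω i).2)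

section Spikes

variable {d s m : ℕ} (pos : Fin s × Fin m ↪ Fin d) (η : ℝ) (ω : Fin s → Fin m × Fin 2)

theorem dotProduct_spikes (w : Fin d → ℝ) :
    w ⬝ᵥ spikes pos η ω = η * ∑ i, groupSign (ω i).2 * w (pos (i, (ω i).1)) := by
  rw [spikes, dotProduct_sum, Finset.mul_sum]
  refine Finset.sum_congr rfl fun i _ => ?_
  rw [dotProduct_single]
  ring

theorem spikes_apply_pos (i : Fin s) :
    spikes pos η ω (pos (i, (ω i).1)) = η * groupSign (ω i).2 := by
  rw [spikes, Finset.sum_apply, Finset.sum_eq_single_of_mem i (Finset.mem_univ i),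
    Pi.single_eq_same]
  refine fun i' _ hi' => Pi.single_eq_of_ne (fun h => hi' ?_) _
  exact (congrArg Prod.fst (pos.injective h)).symm

theorem sum_spikes_sq : ∑ j, spikes pos η ω j ^ 2 = s * η ^ 2 := by
  have hterm (i : Fin s) : groupSign (ω i).2 * (η * groupSign (ω i).2) = η := by
    linear_combination η * groupSign_mul_self (ω i).2
  simp only [sq]
  change spikes pos η ω ⬝ᵥ spikes pos η ω = _
  simp only [dotProduct_spikes, spikes_apply_pos, hterm, Finset.sum_const, Finset.card_univ,
    Fintype.card_fin, nsmul_eq_mul]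
  ring

theorem isSparse_spikes : IsSparse s (spikes pos η ω) := by
  have hsupport : (Finset.univ.filter fun j => spikes pos η ω j ≠ 0) ⊆
      Finset.univ.image fun i => pos (i, (ω i).1) := by
    intro j hj
    obtain ⟨i, hi, hne⟩ : ∃ i ∈ Finset.univ,
        Pi.single (M := fun _ => ℝ) (pos (i, (ω i).1)) (η * groupSign (ω i).2) j ≠ 0 := by
      refine Finset.exists_ne_zero_of_sum_ne_zero ?_
      rw [← Finset.sum_apply]
      exact (Finset.mem_filter.1 hj).2
    refine Finset.mem_image.2 ⟨i, hi, ?_⟩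
    by_contra h
    exact hne (Pi.single_eq_of_ne (Ne.symm h) _)
  exact (Finset.card_le_card hsupport).trans (Finset.card_image_le.trans (by simp))

variable {η}

theorem sqrt_sum_spikes_sq (hη : 0 ≤ η) : √(∑ j, spikes pos η ω j ^ 2) = η * √s := by
  rw [sum_spikes_sq, mul_comm, Real.sqrt_mul (sq_nonneg η), Real.sqrt_sq hη]

theorem mul_sum_spikes_sq_le (hη : 0 ≤ η) {b : ℝ} (hηb : 48 * (η * √s) ≤ b) :
    24 * ∑ j, spikes pos η ω j ^ 2 ≤ b ^ 2 := by
  have hsq := pow_le_pow_left₀ (by positivity) hηb 2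
  rw [mul_pow, mul_pow, Real.sq_sqrt (Nat.cast_nonneg s)] at hsq
  rw [sum_spikes_sq]
  nlinarith [mul_nonneg (Nat.cast_nonneg' (α := ℝ) s) (sq_nonneg η)]

end Spikes

/-! ### The regular regret of the slab instances -/

/-- The hard instance whose customer feature is a vector of random signs, conditioned on log-odds of
size at most `b`. -/
abbrev slabInstance (K : ℕ) {d : ℕ} [NeZero d] (xbar Lbar b : ℝ) (θ : Fin d → ℝ)
    [IsProbabilityMeasure (slabLaw θ b)] : Instance K d :=
  signInstance K xbar Lbar θ (slabLaw θ b)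

/-- The coordinates of the response of a policy with respect to the random signs. -/
def responseCoord {K d : ℕ} [NeZero K] [NeZero d] (π : Policy K d) (xbar : ℝ) (n : ℕ)
    (j : Fin d) (h : Hist K d n) : ℝ :=
  ∫ r, r j * response π xbar n h r ∂signLaw d

section ResponseCoord

variable {K d : ℕ} [NeZero K] [NeZero d] (π : Policy K d) (xbar : ℝ) (n : ℕ)

@[fun_prop]
theorem measurable_responseCoord (j : Fin d) : Measurable (responseCoord π xbar n j) := by
  have hm : Measurable fun q : Hist K d n × (Fin d → ℝ) => q.2 j * response π xbar n q.1 q.2 :=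
    ((measurable_pi_apply j).comp measurable_snd).mul (measurable_response π xbar n)
  exact (hm.stronglyMeasurable.integral_prod_right' (ν := signLaw d)).measurable

theorem sum_responseCoord_sq_le_one (h : Hist K d n) :
    ∑ j, responseCoord π xbar n j h ^ 2 ≤ 1 :=
  sum_integral_signLaw_mul_sq_le_one (by fun_prop) fun r => abs_response_le π xbar n h r

theorem integrable_responseCoord (j : Fin d) (P : Measure (Hist K d n)) [IsFiniteMeasure P] :
    Integrable (responseCoord π xbar n j) P :=
  integrable_of_abs_le (by fun_prop) fun h => (sq_le_one_iff_abs_le_one _).1 <|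
    (Finset.single_le_sum (f := fun j => responseCoord π xbar n j h ^ 2) (fun j _ => sq_nonneg _)
      (Finset.mem_univ j)).trans (sum_responseCoord_sq_le_one π xbar n h)

theorem integral_dotProduct_mul_response (h : Hist K d n) (θ : Fin d → ℝ) :
    ∫ r, (r ⬝ᵥ θ) * response π xbar n h r ∂signLaw d = (responseCoord π xbar n · h) ⬝ᵥ θ := by
  simp only [dotProduct, Finset.sum_mul, mul_right_comm _ (θ _)]
  rw [integral_finsetSum _ fun j _ => (integrable_signLaw_mul (by fun_prop) (by fun_prop)
    fun r => abs_response_le π xbar n h r).mul_const _]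
  simp only [integral_mul_const, responseCoord]

end ResponseCoord

section SlabInstance

variable {K d : ℕ} [NeZero d] {xbar Lbar b : ℝ} {θ : Fin d → ℝ}
  [IsProbabilityMeasure (slabLaw θ b)]

theorem klDiv_histLaw_slabInstance_le (hb : 0 < b) (hb1 : b ≤ 1) (hθ : 24 * ∑ i, θ i ^ 2 ≤ b ^ 2)
    (σ : ℝ≥0) (π : Policy K d) (n : ℕ) :
    klDiv (histLaw (slabInstance K xbar Lbar b θ) σ π n)
        (histLaw (signInstance K xbar Lbar 0 (signLaw d)) σ π n) ≤
      ENNReal.ofReal (n * (4 * (∑ i, θ i ^ 2) / b ^ 2)) := by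
  have hlabel : ∫⁻ z, ENNReal.ofReal ((z ⬝ᵥ θ) ^ 2) ∂slabLaw θ b ≤
      ENNReal.ofReal (2 * (∑ i, θ i ^ 2) / b ^ 2) := by
    rw [← ofReal_integral_eq_lintegral_ofReal
      (integrable_slabLaw hb hθ (by fun_prop)) (ae_of_all _ fun z => sq_nonneg _)]
    refine ENNReal.ofReal_le_ofReal ((integral_slabLaw_sq_le hb hθ θ).trans ?_)
    exact le_div_self (by positivity) (by positivity) (pow_le_one₀ hb.le hb1)
  have hlatent := klDiv_latentLaw_le (μ₁ := slabInstance K xbar Lbar b θ)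
    (μ₂ := signInstance K xbar Lbar 0 (signLaw d)) rfl σ
  rw [klDiv_ctxLaw_signInstance, zLaw_signInstance] at hlatent
  calc _ ≤ n * (ENNReal.ofReal (2 * (∑ i, θ i ^ 2) / b ^ 2) +
          ENNReal.ofReal (2 * (∑ i, θ i ^ 2) / b ^ 2)) := by
        refine (klDiv_histLaw_le (μ₁ := slabInstance K xbar Lbar b θ)
          (μ₂ := signInstance K xbar Lbar 0 (signLaw d)) rfl σ π n).trans ?_
        gcongr
        refine hlatent.trans ?_
        exact add_le_add (klDiv_slabLaw_le hb hθ) hlabel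
    _ = _ := by
        rw [← ENNReal.ofReal_add (by positivity) (by positivity), ← ENNReal.ofReal_natCast,
          ← ENNReal.ofReal_mul (Nat.cast_nonneg n)]
        congr 1
        ring

variable [NeZero K]

theorem le_integral_slabLaw_groupBias (hb : 0 < b) (hb1 : b ≤ 1)
    (hθ : 24 * ∑ i, θ i ^ 2 ≤ b ^ 2) (π : Policy K d) (n : ℕ) (h : Hist K d n) :
    (√(∑ i, θ i ^ 2) / 3 - 2 * (∑ i, θ i ^ 2) / b - (responseCoord π xbar n · h) ⬝ᵥ θ) / 4 ≤
      ∫ z, (|groupBias (z ⬝ᵥ θ)| - groupBias (z ⬝ᵥ θ) * response π xbar n h z) ∂slabLaw θ b := by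
  have hslab := le_integral_slabLaw_abs_sub_mul hb hθ (f := response π xbar n h) (by fun_prop)
    fun r => abs_response_le π xbar n h r
  have hmono : ∫ z, (|z ⬝ᵥ θ| - (z ⬝ᵥ θ) * response π xbar n h z) / 4 ∂slabLaw θ b ≤
      ∫ z, (|groupBias (z ⬝ᵥ θ)| - groupBias (z ⬝ᵥ θ) * response π xbar n h z) ∂slabLaw θ b := by
    refine integral_mono_ae ?_ ?_ ?_
    · exact ((integrable_slabLaw hb hθ (by fun_prop)).sub
        ((integrable_slabLaw hb hθ (by fun_prop)).mul_bdd (c := 1) (by fun_prop)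
          (ae_of_all _ fun z => abs_response_le π xbar n h z))).div_const 4
    · exact integrable_of_abs_le (by fun_prop) fun z =>
        abs_abs_groupBias_sub_mul_le _ (abs_response_le π xbar n h z)
    · filter_upwards [ae_slabLaw_abs_dotProduct_le] with z hz
      exact abs_sub_mul_div_four_le_groupBias (hz.trans hb1) (abs_response_le π xbar n h z)
  rw [integral_div] at hmono
  rw [integral_dotProduct_mul_response] at hslab
  linarith

theorem le_integral_instantRegular_slabInstance (hK : 2 ≤ K) (hx : 0 < xbar) (hL : 0 < Lbar)
    (hb : 0 < b) (hb1 : b ≤ 1) (hθ : 24 * ∑ i, θ i ^ 2 ≤ b ^ 2) (σ : ℝ≥0) (π : Policy K d)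
    (n : ℕ) :
    xbar * Lbar / 4 * (√(∑ i, θ i ^ 2) / 3 - 2 * (∑ i, θ i ^ 2) / b -
        ∫ h, (responseCoord π xbar n · h) ⬝ᵥ θ ∂histLaw (slabInstance K xbar Lbar b θ) σ π n) ≤
      ∫ w, instantRegular (slabInstance K xbar Lbar b θ) w
        ∂roundLaw (slabInstance K xbar Lbar b θ) σ π n := by
  rw [integral_instantRegular hK hx hL, mul_comm_div]
  refine mul_le_mul_of_nonneg_left ?_ (mul_pos hx hL).le
  have hcoord : Integrable (fun h => (responseCoord π xbar n · h) ⬝ᵥ θ)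
      (histLaw (slabInstance K xbar Lbar b θ) σ π n) :=
    integrable_finsetSum _ fun j _ => (integrable_responseCoord π xbar n j _).mul_const _
  have hright : Integrable (fun h => ∫ z, (|groupBias (z ⬝ᵥ θ)| -
      groupBias (z ⬝ᵥ θ) * response π xbar n h z) ∂slabLaw θ b)
      (histLaw (slabInstance K xbar Lbar b θ) σ π n) := by
    have hm : Measurable fun q : Hist K d n × (Fin d → ℝ) =>
        |groupBias (q.2 ⬝ᵥ θ)| - groupBias (q.2 ⬝ᵥ θ) * response π xbar n q.1 q.2 :=
      (by fun_prop : Measurable fun q : Hist K d n × (Fin d → ℝ) => |groupBias (q.2 ⬝ᵥ θ)|).sub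
        ((by fun_prop : Measurable fun q : Hist K d n × (Fin d → ℝ) =>
          groupBias (q.2 ⬝ᵥ θ)).mul (measurable_response π xbar n))
    exact integrable_of_abs_le
      (hm.stronglyMeasurable.integral_prod_right' (ν := slabLaw θ b)).measurable fun h =>
        abs_integral_le_of_abs_le fun z =>
          abs_abs_groupBias_sub_mul_le _ (abs_response_le π xbar n h z)
  refine le_trans (le_of_eq ?_) (integral_mono (((integrable_const _).sub hcoord).div_const 4)
    hright fun h => le_integral_slabLaw_groupBias hb hb1 hθ π n h)
  rw [integral_div]
  simp [integral_sub (integrable_const _) hcoord]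

end SlabInstance

/-! ### Sparse subgroup models -/

section SpikeInstances

variable {K d s m : ℕ} [NeZero K] [NeZero d] {xbar Lbar b η : ℝ} (pos : Fin s × Fin m ↪ Fin d)
  [∀ ω, IsProbabilityMeasure (slabLaw (spikes pos η ω) b)]

theorem sum_integral_responseCoord_dotProduct_spikes_le (hs : 0 < s) (hm : 0 < m) (hb : 0 < b)
    (hb1 : b ≤ 1) (hη : 0 ≤ η) (hηb : 48 * (η * √s) ≤ b) {n : ℕ}
    (hηn : 4608 * (η ^ 2 * n) ≤ b ^ 2 * Real.log (2 * m)) (σ : ℝ≥0) (π : Policy K d) :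
    ∑ ω, ∫ h, (responseCoord π xbar n · h) ⬝ᵥ spikes pos η ω
        ∂histLaw (slabInstance K xbar Lbar b (spikes pos η ω)) σ π n ≤
      Fintype.card (Fin s → Fin m × Fin 2) * (η * √s / 8) := by
  have : Nonempty (Fin m) := ⟨⟨0, hm⟩⟩
  have hlog : 0 < Real.log (2 * m) :=
    Real.log_pos (by linarith [Nat.one_le_cast (α := ℝ).2 hm])
  have hsum (h : Hist K d n) : ∑ p, responseCoord π xbar n (pos p) h ^ 2 ≤ 1 := by
    rw [← Finset.sum_map Finset.univ pos fun j => responseCoord π xbar n j h ^ 2]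
    exact (Finset.sum_le_univ_sum_of_nonneg fun j => sq_nonneg _).trans
      (sum_responseCoord_sq_le_one π xbar n h)
  have hkl (ω : Fin s → Fin m × Fin 2) := klDiv_histLaw_slabInstance_le (K := K) (xbar := xbar)
    (Lbar := Lbar) hb hb1 (mul_sum_spikes_sq_le pos ω hη hηb) σ π n
  simp only [sum_spikes_sq] at hkl
  have hbound := sum_integral_sum_groupSign_mul_le (ρ := 24 / √s) (by positivity) hkl
    (fun p => measurable_responseCoord π xbar n (pos p)) (by positivity) hsum
  have hinfo : 2 * (24 / √s) * (n * (4 * (s * η ^ 2) / b ^ 2)) / Real.log (2 * m) ≤ √s / 24 := by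
    rw [div_le_iff₀ hlog]
    calc 2 * (24 / √s) * (n * (4 * (s * η ^ 2) / b ^ 2))
        = √s / 24 * (4608 * (η ^ 2 * n) / b ^ 2) := by
          nth_rw 2 [← Real.sq_sqrt (Nat.cast_nonneg s)]
          field_simp
          ring
      _ ≤ √s / 24 * Real.log (2 * m) := by
          gcongr
          rwa [div_le_iff₀' (by positivity)]
  rw [Fintype.card_fin] at hbound
  simp only [dotProduct_spikes, integral_const_mul]
  rw [← Finset.mul_sum]
  calc _ ≤ η * (Fintype.card (Fin s → Fin m × Fin 2) * (√s / 24 + 2 / (24 / √s))) := by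
        refine mul_le_mul_of_nonneg_left (hbound.trans ?_) hη
        gcongr
    _ = _ := by
        field_simp
        ring

theorem le_sum_integral_instantRegular_spikes (hK : 2 ≤ K) (hx : 0 < xbar) (hL : 0 < Lbar)
    (hs : 0 < s) (hm : 0 < m) (hb : 0 < b) (hb1 : b ≤ 1) (hη : 0 ≤ η) (hηb : 48 * (η * √s) ≤ b)
    {n : ℕ} (hηn : 4608 * (η ^ 2 * n) ≤ b ^ 2 * Real.log (2 * m)) (σ : ℝ≥0) (π : Policy K d) :
    Fintype.card (Fin s → Fin m × Fin 2) * (xbar * Lbar / 24 * (η * √s)) ≤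
      ∑ ω, ∫ w, instantRegular (slabInstance K xbar Lbar b (spikes pos η ω)) w
        ∂roundLaw (slabInstance K xbar Lbar b (spikes pos η ω)) σ π n := by
  have hcoord := sum_integral_responseCoord_dotProduct_spikes_le (K := K) (xbar := xbar)
    (Lbar := Lbar) pos hs hm hb hb1 hη hηb hηn σ π
  have hquad : 2 * (s * η ^ 2) / b ≤ η * √s / 24 := by
    have hδ : s * η ^ 2 = (η * √s) ^ 2 := by
      rw [mul_pow, Real.sq_sqrt (Nat.cast_nonneg s), mul_comm]
    rw [hδ, div_le_div_iff₀ hb (by norm_num)]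
    nlinarith [mul_nonneg hη (Real.sqrt_nonneg s)]
  refine le_trans ?_ (Finset.sum_le_sum fun ω _ => le_integral_instantRegular_slabInstance hK hx hL
    hb hb1 (mul_sum_spikes_sq_le pos ω hη hηb) σ π n)
  simp only [sqrt_sum_spikes_sq pos _ hη]
  simp only [sum_spikes_sq]
  rw [← Finset.mul_sum, Finset.sum_sub_distrib, Finset.sum_const, Finset.card_univ, nsmul_eq_mul]
  calc Fintype.card (Fin s → Fin m × Fin 2) * (xbar * Lbar / 24 * (η * √s))
      = xbar * Lbar / 4 * (Fintype.card (Fin s → Fin m × Fin 2) * (η * √s / 3 - η * √s / 24) -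
          Fintype.card (Fin s → Fin m × Fin 2) * (η * √s / 8)) := by ring
    _ ≤ _ := by gcongr

theorem exists_le_regularRegret_spikes (hK : 2 ≤ K) (hx : 0 < xbar) (hL : 0 < Lbar)
    (hs : 0 < s) (hm : 0 < m) (hb : 0 < b) (hb1 : b ≤ 1) (hη : 0 ≤ η) (hηb : 48 * (η * √s) ≤ b)
    {T : ℕ} (hηT : 4608 * (η ^ 2 * T) ≤ b ^ 2 * Real.log (2 * m)) (σ : ℝ≥0) (π : Policy K d) :
    ∃ ω, xbar * Lbar / 24 * (T * (η * √s)) ≤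
      regularRegret (slabInstance K xbar Lbar b (spikes pos η ω)) σ π T := by
  have : Nonempty (Fin m) := ⟨⟨0, hm⟩⟩
  have htotal : ∑ _ω : Fin s → Fin m × Fin 2, xbar * Lbar / 24 * (T * (η * √s)) ≤
      ∑ ω, regularRegret (slabInstance K xbar Lbar b (spikes pos η ω)) σ π T := by
    simp only [regularRegret]
    rw [Finset.sum_comm]
    refine le_trans (le_of_eq ?_) (Finset.sum_le_sum fun n hn =>
      le_sum_integral_instantRegular_spikes pos hK hx hL hs hm hb hb1 hη hηb (hηT.trans' ?_) σ π)
    · simp only [Finset.sum_const, Finset.card_univ, Finset.card_range, nsmul_eq_mul]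
      ring
    · gcongr
      exact (Finset.mem_range.1 hn).le
  obtain ⟨ω, -, hω⟩ := Finset.exists_le_of_sum_le Finset.univ_nonempty htotal
  exact ⟨ω, hω⟩

end SpikeInstances

/-! ### Lower bounds for the regrets -/

theorem sigmoid_mem_Ioo_of_abs_lt {ξ u : ℝ} (hξ : 0 < ξ) (hξ1 : ξ < 1)
    (hu : |u| < Real.log ((1 - ξ) / ξ)) : Real.sigmoid u ∈ Set.Ioo ξ (1 - ξ) := by
  have hlogit : Real.sigmoid (Real.log ((1 - ξ) / ξ)) = 1 - ξ := by
    rw [Real.sigmoid_def, Real.exp_neg, Real.exp_log (div_pos (sub_pos.2 hξ1) hξ)]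
    have := sub_pos.2 hξ1
    field_simp
    ring
  obtain ⟨hlower, hupper⟩ := abs_lt.1 hu
  have hξu := Real.sigmoid_strictMono hlower
  rw [Real.sigmoid_neg, hlogit] at hξu
  exact ⟨by linarith, (Real.sigmoid_strictMono hupper).trans_eq hlogit⟩

theorem nondegenerateGroups_slabLaw {d : ℕ} (θ : Fin d → ℝ) {ξ b : ℝ} (hξ : 0 < ξ) (hξ1 : ξ < 1)
    (hb : b < Real.log ((1 - ξ) / ξ)) : NondegenerateGroups ξ θ (slabLaw θ b) := by
  filter_upwards [ae_slabLaw_abs_dotProduct_le] with z hz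
  exact sigmoid_mem_Ioo_of_abs_lt hξ hξ1 (hz.trans_lt hb)

theorem log_div_le_log_two_mul_natDiv {d s : ℕ} (hs : 1 ≤ s) (hsd : s ≤ d) :
    Real.log (d / s) ≤ Real.log (2 * (d / s : ℕ)) := by
  have hs0 : (0 : ℝ) < s := Nat.cast_pos.2 hs
  have hd0 : (0 : ℝ) < d := Nat.cast_pos.2 (hs.trans hsd)
  refine Real.log_le_log (by positivity) ((div_le_iff₀ hs0).2 ?_)
  have hmod : d ≤ 2 * (d / s) * s := by
    nlinarith [Nat.div_add_mod d s, Nat.mod_lt d hs, Nat.mul_le_mul_left s (Nat.div_pos hsd hs)]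
  exact_mod_cast hmod

/- The spikes have the largest size for which `T` rounds do not reveal their positions. -/
theorem exists_spike_size {A b s l l' T : ℝ} (hA : 0 < A) (hb : 0 ≤ b) (hs : 0 ≤ s) (hT : 0 ≤ T)
    (hl : 0 ≤ l) (hll' : l ≤ A * l') (hsl : s * l ≤ A * T) :
    ∃ η, 0 ≤ η ∧ 48 * (η * √s) ≤ b ∧ 4608 * (η ^ 2 * T) ≤ b ^ 2 * l' ∧
      √(b ^ 2 / (4608 * A)) * (√(s * l) * √T) = T * (η * √s) := by
  have hsq : √(b ^ 2 / (4608 * A) * l / T) ^ 2 = b ^ 2 / (4608 * A) * l / T :=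
    Real.sq_sqrt (by positivity)
  refine ⟨√(b ^ 2 / (4608 * A) * l / T), Real.sqrt_nonneg _, ?_, ?_, ?_⟩
  · refine (pow_le_pow_iff_left₀ (by positivity) hb two_ne_zero).1 ?_
    rw [mul_pow, mul_pow, hsq, Real.sq_sqrt hs]
    calc 48 ^ 2 * (b ^ 2 / (4608 * A) * l / T * s) = b ^ 2 / (2 * A) * (s * l / T) := by ring
      _ ≤ b ^ 2 / (2 * A) * A := by
        gcongr
        exact div_le_of_le_mul₀ hT hA.le hsl
      _ ≤ b ^ 2 := by
        field_simp
        linarith [sq_nonneg b]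
  · rw [hsq]
    calc 4608 * (b ^ 2 / (4608 * A) * l / T * T) = b ^ 2 * (l / A) * (T / T) := by
          field_simp
      _ ≤ b ^ 2 * l' * 1 := by
          have hl' : l / A ≤ l' := (div_le_iff₀' hA).2 hll'
          have := div_self_le_one T
          gcongr
          exact mul_nonneg (sq_nonneg b) ((by positivity : 0 ≤ l / A).trans hl')
      _ = b ^ 2 * l' := mul_one _
  · rw [Real.sqrt_div (x := _ * l) (by positivity), Real.sqrt_mul hs l,
      Real.sqrt_mul (x := b ^ 2 / _) (by positivity)]
    nth_rw 1 [← Real.div_sqrt (x := T)]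
    ring

section RegretBounds

variable {K d s T : ℕ} [NeZero K] {xbar Lbar ξ M κ C hbar : ℝ}

theorem exists_inClass_le_strongRegret (hK : 2 ≤ K) (hs : 1 ≤ s) (hsd : s ≤ d) (hx : 0 < xbar)
    (hL : 0 < Lbar) (hM₁ : xbar ^ 2 < M) (hM₂ : 4 / xbar ^ 2 < M) {κz : ℝ} (hκz : 0 < κz)
    (hκ : 2 * xbar + κz ≤ κ) (hC : 0 < C) (hh : hbar ≤ xbar * Lbar / 4) {θ : Fin d → ℝ}
    {ν : Measure (Fin d → ℝ)} [IsProbabilityMeasure ν] (hθ : IsSparse s θ)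
    (hnd : NondegenerateGroups ξ θ ν) (hsub : IsSubGaussian ν id κz)
    (heig : EigenvaluesWithin M (secondMoment ν id)) (σ : ℝ≥0) (π : Policy K d) :
    ∃ μ : Instance K d, InClass s xbar Lbar ξ M κ C hbar μ ∧ μ.θ = θ ∧ μ.zLaw = ν ∧
      2 * (xbar * Lbar * misclassError θ ν * T) ≤ strongRegret μ σ π T := by
  have : NeZero d := ⟨by omega⟩
  refine ⟨signInstance K xbar Lbar θ ν,
    inClass_signInstance hK hs hx hL hM₁ hM₂ hκz hκ hC hh hθ hnd hsub heig, rfl,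
    zLaw_signInstance, ?_⟩
  calc 2 * (xbar * Lbar * misclassError θ ν * T)
      = ∑ _n ∈ Finset.range T, 2 * (xbar * Lbar) * misclassError θ ν := by
        rw [Finset.sum_const, Finset.card_range, nsmul_eq_mul]
        ring
    _ ≤ _ := Finset.sum_le_sum fun n _ => integral_instantStrong_ge hK hx hL σ π n

theorem exists_inClass_le_regularRegret {A b : ℝ} (hA : 0 < A) (hb : 0 < b) (hb1 : b ≤ 1)
    (hξ : 0 < ξ) (hξ1 : ξ < 1) (hbξ : b < Real.log ((1 - ξ) / ξ)) (hK : 2 ≤ K) (hs : 1 ≤ s)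
    (hsd : s ≤ d) (hx : 0 < xbar) (hL : 0 < Lbar) (hM₁ : xbar ^ 2 < M) (hM₂ : 4 / xbar ^ 2 < M)
    (hM : 4 ≤ M) (hκ : 2 * xbar + 2 ≤ κ) (hC : 0 < C) (hh : hbar ≤ xbar * Lbar / 4)
    (hAd : Real.log d ≤ A * Real.log (d / s)) (hAT : s * Real.log d ≤ A * T) (σ : ℝ≥0)
    (π : Policy K d) :
    ∃ μ : Instance K d, InClass s xbar Lbar ξ M κ C hbar μ ∧
      √(b ^ 2 / (4608 * A)) / 24 * (xbar * Lbar * √(s * Real.log d) * √T) ≤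
        regularRegret μ σ π T := by
  have : NeZero d := ⟨by omega⟩
  obtain ⟨η, hη, hηb, hηT, hrate⟩ := exists_spike_size (l' := Real.log (2 * (d / s : ℕ))) hA hb.le
    (Nat.cast_nonneg s) (Nat.cast_nonneg T) (Real.log_natCast_nonneg d)
    (hAd.trans (mul_le_mul_of_nonneg_left (log_div_le_log_two_mul_natDiv hs hsd) hA.le)) hAT
  let pos : Fin s × Fin (d / s) ↪ Fin d :=
    finProdFinEquiv.toEmbedding.trans (Fin.castLEEmb (Nat.mul_div_le d s))
  have hsmall := fun ω => mul_sum_spikes_sq_le pos ω hη hηb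
  have := fun ω => isProbabilityMeasure_slabLaw hb (hsmall ω)
  obtain ⟨ω, hω⟩ := exists_le_regularRegret_spikes (T := T) pos hK hx hL hs (Nat.div_pos hsd hs) hb
    hb1 hη hηb hηT σ π
  refine ⟨slabInstance K xbar Lbar b (spikes pos η ω), inClass_signInstance hK hs hx hL hM₁ hM₂
    two_pos hκ hC hh (isSparse_spikes pos η ω) (nondegenerateGroups_slabLaw _ hξ hξ1 hbξ)
    (isSubGaussian_slabLaw hb (hsmall ω)) (eigenvaluesWithin_slabLaw hb (hsmall ω) hM),
    hω.trans' (le_of_eq ?_)⟩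
  rw [← hrate]
  ring

end RegretBounds

end LatentBandit

end

theorem theorem4 :
    -- strong regret, for each subgroup model and each law of the customer feature
    (∃ c : ℝ, 0 < c ∧ ∀ xbar Lbar : ℝ, 0 < xbar → 0 < Lbar →
      ∃ M₀ κ₀ h₀ : ℝ, 0 < M₀ ∧ 0 < κ₀ ∧ 0 < h₀ ∧
      ∀ ξ M κz κ C hbar : ℝ, 0 < ξ → ξ < 1 / 2 → 1 < M → M₀ ≤ M → 0 < κz → κ₀ + κz ≤ κ →
        0 < C → 0 < hbar → hbar ≤ h₀ →
      ∀ σ : NNReal, 0 < σ → ∀ (K d s T : ℕ) [NeZero K], 2 ≤ K → 1 ≤ s → s ≤ d →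
      ∀ (θ : Fin d → ℝ) (ν : MeasureTheory.Measure (Fin d → ℝ)),
        MeasureTheory.IsProbabilityMeasure ν →
        LatentBandit.IsSparse s θ → LatentBandit.NondegenerateGroups ξ θ ν →
        LatentBandit.IsSubGaussian ν id κz →
        LatentBandit.EigenvaluesWithin M (LatentBandit.secondMoment ν id) →
      ∀ π : LatentBandit.Policy K d, ∃ μ : LatentBandit.Instance K d,
        LatentBandit.InClass s xbar Lbar ξ M κ C hbar μ ∧ μ.θ = θ ∧ μ.zLaw = ν ∧
        c * (xbar * Lbar * LatentBandit.misclassError θ ν * T) ≤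
          LatentBandit.strongRegret μ σ π T) ∧
    -- regular regret
    (∀ A ξ : ℝ, 0 < A → 0 < ξ → ξ < 1 / 2 →
      ∃ c : ℝ, 0 < c ∧ ∀ xbar Lbar : ℝ, 0 < xbar → 0 < Lbar →
      ∃ M₀ κ₀ h₀ : ℝ, 0 < M₀ ∧ 0 < κ₀ ∧ 0 < h₀ ∧
      ∀ M κ C hbar : ℝ, 1 < M → M₀ ≤ M → κ₀ ≤ κ → 0 < C → 0 < hbar → hbar ≤ h₀ →
      ∀ σ : NNReal, 0 < σ → ∀ (K d s T : ℕ) [NeZero K], 2 ≤ K → 1 ≤ s → s ≤ d →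
        Real.log d ≤ A * Real.log (d / s) → s * Real.log d ≤ A * T →
      ∀ π : LatentBandit.Policy K d, ∃ μ : LatentBandit.Instance K d,
        LatentBandit.InClass s xbar Lbar ξ M κ C hbar μ ∧
        c * (xbar * Lbar * Real.sqrt (s * Real.log d) * Real.sqrt T) ≤
          LatentBandit.regularRegret μ σ π T) := by
  refine ⟨⟨2, two_pos, fun xbar Lbar hx hL => ⟨xbar ^ 2 + 4 / xbar ^ 2 + 1, 2 * xbar,
    xbar * Lbar / 4, by positivity, by positivity, by positivity, ?_⟩⟩, fun A ξ hA hξ hξ' => ?_⟩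
  · intro ξ M κz κ C hbar hξ hξ' hM1 hM hκz hκ hC hh0 hh σ hσ K d s T _ hK hs hsd θ ν hν hθ hnd
      hsub heig π
    have hx2 : 0 < xbar ^ 2 := by positivity
    have hx4 : 0 < 4 / xbar ^ 2 := by positivity
    exact LatentBandit.exists_inClass_le_strongRegret hK hs hsd hx hL (by linarith) (by linarith)
      hκz hκ hC hh hθ hnd hsub heig σ π
  · have hlogit : 0 < Real.log ((1 - ξ) / ξ) := Real.log_pos ((one_lt_div hξ).2 (by linarith))
    obtain ⟨b, hb, hbmin⟩ := exists_between (lt_min one_pos hlogit)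
    obtain ⟨hb1, hbξ⟩ := lt_min_iff.1 hbmin
    refine ⟨√(b ^ 2 / (4608 * A)) / 24, by positivity, fun xbar Lbar hx hL =>
      ⟨xbar ^ 2 + 4 / xbar ^ 2 + 4, 2 * xbar + 2, xbar * Lbar / 4, by positivity, by positivity,
        by positivity, ?_⟩⟩
    intro M κ C hbar hM1 hM hκ hC hh0 hh σ hσ K d s T _ hK hs hsd hAd hAT π
    have hx2 : 0 < xbar ^ 2 := by positivity
    have hx4 : 0 < 4 / xbar ^ 2 := by positivity
    exact LatentBandit.exists_inClass_le_regularRegret hA hb hb1.le hξ (by linarith) hbξ hK hs hsd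
      hx hL (by linarith) (by linarith) (by linarith) hκ hC hh hAd hAT σ π
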